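/- **Theorem 7.1 (direct way for the left key).** Fix $n\ge 1$ and order the letters by $1<\dots<n<\overline n<\dots<\overline 1$, with $\overline{\overline i}=i$. A column is a strictly increasing sequence of letters (from top to bottom). A column $C$ is *admissible* if for every $i\in[n]$ with $i,\overline i\in C$, at most $i$ letters $x$ of $C$ satisfy $x\le i$ or $x\ge\overline i$. For $C$ admissible let $z_1>\dots>z_r$ be the unbarred letters $z$ with $z,\overline z\in C$, and let $t_1>\dots>t_r$ be such that $t_i$ is the greatest letter of $[n]$ with $t_i<z_i$, $t_i<t_{i-1}$ (if $i>1$), $t_i\notin C$, $\overline{t_i}\notin C$. The left column $\ell C$ is obtained from $C$ by replacing each $z_i$ by $t_i$, the right column $rC$ by replacing each $\overline{z_i}$ by $\overline{t_i}$, and $\Phi(C)$ consists of the unbarred letters of $\ell C$ and the barred letters of $rC$; $\Phi$ is injective on admissible columns. A *KN tableau* is a semistandard tableau $T=C_1\cdots C_k$ of straight shape ($k\ge1$ nonempty columns $C_1,\dots,C_k$), all of whose columns are admissible and whose split form $\ell C_1\,rC_1\cdots\ell C_k\,rC_k$ is semistandard. *Left key via symplectic jeu de taquin.* A (reverse) slide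 on a two-column skew tableau with columns $C,D$ starts with a puncture directly below $D$, in a box that can be added to the shape. Let $b$ be the letter of $rC$ to the left of the puncture and $a$ the letter of $\ell D$ above it. If $b\le a$ or $b$ does not exist, the puncture moves up by one box. Otherwise $b$ slides to the right: if $b$ is barred, $C,D$ become $\Phi^{-1}(\Phi(C)\setminus\{b\})$, $D\cup\{b\}$; if $b$ is unbarred, they become $C\setminus\{b\}$, $\Phi^{-1}(\Phi(D)\cup\{b\})$; then the puncture moves up through the left column and out of the tableau. For a KN tableau $T=C_1\cdots C_k$ put $X_k=C_k$. For $i=k-1,\dots,1$, starting from the straight tableau with columns $C_i,X_{i+1}$, make slides until the two column lengths are swapped (none if they are equal), and let $X_i$ be the left column of the result. Then $K_-^1(T):=\ell X_1$; it is the last column of the symplectic left key of $T$. *Direct way.* Put $\ell C_k'=\ell C_k$. For $i=k-1,\dots,1$, match $rC_i$ with $\ell C_{i+1}'$: going through the letters $\beta$ of $\ell C_{i+1}'$ from the biggest to the smallest, match $\beta$ with the biggest not yet matched letter $\le\beta$ of $rC_i$. Then go through the unmatched letters of $rC_i$ from the smallest to the biggest. For each such letter $\beta$, start at the entry of the left column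 (initially $\ell C_i$) in the row of $\beta$ and, going up, delete the first entry that is bigger than the entry of the right column (initially $rC_i$) directly Northeast of it, i.e. in the row above; if there is no such entry, delete the top entry of the left column. Also delete $\beta$ from the right column. After each deletion the entries below the deleted box move up by one row in the column concerned. What remains of $\ell C_i$ in the end is $\ell C_i'$. Then, for every KN tableau $T=C_1\cdots C_k$, the column $\ell C_1'$ consists of letters of $\ell C_1$, has the same length as $C_k$, and $$\ell C_1'=K_-^1(T).$$ In particular all the slides above can be carried out. -/

import Mathlib

namespace KN

/-- The alphabet `[±n] = {1 < ⋯ < n < n̄ < ⋯ < 1̄}`, as the chain `0 < 1 < ⋯ < 2n - 1`: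
the letter `i` is `i - 1`, and the letter `ī` is `2n - i`. -/
abbrev Letter (n : ℕ) : Type := Fin (2 * n)

/-- The involution `i ↔ ī` of the alphabet. -/
def bar {n : ℕ} (x : Letter n) : Letter n := Fin.rev x

/-- The letters `1, …, n`. -/
def Unbarred {n : ℕ} (x : Letter n) : Prop := x.val < n

instance {n : ℕ} (x : Letter n) : Decidable (Unbarred x) :=
  inferInstanceAs (Decidable (x.val < n))

/-- A column is a strictly increasing sequence of letters, that is, a finite set of letters. -/
abbrev Column (n : ℕ) : Type := Finset (Letter n)

/-- The entries of a column from top to bottom; row `r` (counted from `0`) is `(rows C)[r]?`. -/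
def rows {n : ℕ} (C : Column n) : List (Letter n) := C.sort (· ≤ ·)

/-- The one column condition: for every pair `i`, `ī` in `C`, the number `N(i)` of letters `x` in
`C` with `x ≤ i` or `ī ≤ x` is at most `i` (the letter `z` below stands for `i = z + 1`). -/
def Admissible {n : ℕ} (C : Column n) : Prop :=
  ∀ z ∈ C, Unbarred z → bar z ∈ C → (C.filter fun x => x ≤ z ∨ bar z ≤ x).card ≤ z.val + 1

/-- The set `I` of unbarred letters `z` such that both `z` and `z̄` occur in `C`. -/
def pairs {n : ℕ} (C : Column n) : Finset (Letter n) :=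
  C.filter fun z => Unbarred z ∧ bar z ∈ C

/-- The letters that may be chosen as the next `t` for the letter `z`, if the letters of `J` have
been chosen before: unbarred letters below `z` and below `J`, absent from `C` with their bars. -/
def splitCandidates {n : ℕ} (C : Column n) (z : Letter n) (J : Finset (Letter n)) :
    Finset (Letter n) :=
  Finset.univ.filter fun t => Unbarred t ∧ t < z ∧ (∀ s ∈ J, t < s) ∧ t ∉ C ∧ bar t ∉ C

/-- Run through the given letters `z` and choose for each one the greatest candidate. -/
def splitAux {n : ℕ} (C : Column n) : List (Letter n) → Finset (Letter n) → Finset (Letter n)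
  | [], J => J
  | z :: zs, J =>
    if h : (splitCandidates C z J).Nonempty then
      splitAux C zs (insert ((splitCandidates C z J).max' h) J)
    else splitAux C zs J

/-- The set `J = {t₁ > ⋯ > t_r}` attached to `I = {z₁ > ⋯ > z_r}`: `t₁` is the greatest letter of
`[n]` with `t₁ < z₁`, `t₁ ∉ C`, `t̄₁ ∉ C`, and `t_i` is the greatest letter of `[n]` with
`t_i < min(t_{i-1}, z_i)`, `t_i ∉ C`, `t̄_i ∉ C`. All these letters exist if and only if `C` is
admissible; the definition is only meant for such columns. -/
def splitSet {n : ℕ} (C : Column n) : Finset (Letter n) :=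
  splitAux C (rows (pairs C)).reverse ∅

/-- The left column `ℓC`: each `z_i ∈ I` is replaced by `t_i`. -/
def leftCol {n : ℕ} (C : Column n) : Column n := (C \ pairs C) ∪ splitSet C

/-- The right column `rC`: each `z̄_i` with `z_i ∈ I` is replaced by `t̄_i`. -/
def rightCol {n : ℕ} (C : Column n) : Column n :=
  (C \ (pairs C).image bar) ∪ (splitSet C).image bar

/-- The coadmissible column `Φ(C)`: the unbarred entries of `ℓC` and the barred entries of `rC`. -/
def coadm {n : ℕ} (C : Column n) : Column n :=
  (leftCol C).filter (fun x => Unbarred x) ∪ (rightCol C).filter (fun x => ¬ Unbarred x)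

/-- Two adjacent top-aligned columns: the right one is not longer, and rows increase weakly. -/
def RowLE {n : ℕ} (C D : Column n) : Prop :=
  D.card ≤ C.card ∧ ∀ (r : ℕ) (x y : Letter n),
    (rows C)[r]? = some x → (rows D)[r]? = some y → x ≤ y

/-- Semistandard tableaux of straight shape, as lists of columns from left to right. -/
def Semistandard {n : ℕ} (T : List (Column n)) : Prop := T.IsChain RowLE

/-- The split form `ℓC₁ rC₁ ℓC₂ rC₂ ⋯ ℓC_k rC_k`. -/
def spl {n : ℕ} (T : List (Column n)) : List (Column n) :=
  T.flatMap fun C => [leftCol C, rightCol C]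

/-- Kashiwara–Nakashima tableaux of straight shape on the alphabet `[±n]`, as lists of (nonempty)
columns from left to right. -/
structure IsTableau {n : ℕ} (T : List (Column n)) : Prop where
  nonempty : ∀ C ∈ T, C.Nonempty
  admissible : ∀ C ∈ T, Admissible C
  semistandard : Semistandard T
  split_semistandard : Semistandard (spl T)

/-! ### Symplectic jeu de taquin on two columns

A two-column skew tableau is given by its columns `C` (left) and `D` (right) and a number `j`:
`D` starts in row `0` and `C` starts in row `j`. -/

/-- In the split form, the letter `b` is the left neighbour of the puncture if the puncture is in
row `p` of the right column: `b` is the entry in row `p` of `rC`. -/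
def LeftOfPuncture {n : ℕ} (j : ℕ) (C : Column n) (p : ℕ) (b : Letter n) : Prop :=
  j ≤ p ∧ (rows (rightCol C))[p - j]? = some b

/-- In the split form, the letter `a` is directly above the puncture if the puncture is in
row `p` of the right column: `a` is the entry in row `p - 1` of `ℓD`. -/
def AbovePuncture {n : ℕ} (D : Column n) (p : ℕ) (a : Letter n) : Prop :=
  ∃ q, p = q + 1 ∧ (rows (leftCol D))[q]? = some a

/-- `ReverseSlide j C D p C' D'`: a puncture in row `p` of the right column is moved by the
elementary steps of the (reverse) symplectic jeu de taquin out of the tableau, the columns being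
`C', D'` in the end.
* If the letter above the puncture is at least its left neighbour, or there is no left neighbour,
  the puncture moves up.
* Otherwise the left neighbour `b` moves into the right column, and the puncture into the left one.
  A barred `b` goes from `Φ(C)` to `D`, an unbarred `b` goes from `C` to `Φ(D)`. All columns have to
  be admissible again. Then the puncture has no left neighbour any more, moves up to the top of the
  left column, and leaves the tableau there; so the left column now starts in row `j + 1`. -/
inductive ReverseSlide {n : ℕ} (j : ℕ) (C D : Column n) : ℕ → Column n → Column n → Prop
  | up {p : ℕ} {a : Letter n} {C' D' : Column n} (above : AbovePuncture D (p + 1) a)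
      (le : ∀ b, LeftOfPuncture j C (p + 1) b → b ≤ a) (next : ReverseSlide j C D p C' D') :
      ReverseSlide j C D (p + 1) C' D'
  | barred {p : ℕ} {b : Letter n} {C' : Column n} (left : LeftOfPuncture j C p b)
      (lt : ∀ a, AbovePuncture D p a → a < b) (hb : ¬ Unbarred b) (fresh : b ∉ D)
      (adm_left : Admissible C') (adm_right : Admissible (insert b D))
      (hC' : coadm C' = (coadm C).erase b) :
      ReverseSlide j C D p C' (insert b D)
  | unbarred {p : ℕ} {b : Letter n} {D' : Column n} (left : LeftOfPuncture j C p b)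
      (lt : ∀ a, AbovePuncture D p a → a < b) (hb : Unbarred b) (fresh : b ∉ coadm D)
      (adm_left : Admissible (C.erase b)) (adm_right : Admissible D')
      (hD' : coadm D' = insert b (coadm D)) :
      ReverseSlide j C D p (C.erase b) D'

/-- `SlidePath C D j C' D'`: starting from the straight tableau with columns `C, D`, one gets the
skew tableau with columns `C', D'`, the left one starting in row `j`, by `j` slides. Each slide
starts with a puncture directly below the right column, in a box that can be added to the shape. -/
inductive SlidePath {n : ℕ} (C D : Column n) : ℕ → Column n → Column n → Prop
  | start : SlidePath C D 0 C D
  | slide {j : ℕ} {C₁ D₁ C₂ D₂ : Column n} (path : SlidePath C D j C₁ D₁)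
      (corner : D₁.card < j + C₁.card) (step : ReverseSlide j C₁ D₁ D₁.card C₂ D₂) :
      SlidePath C D (j + 1) C₂ D₂

/-- The jeu de taquin played on the straight tableau `C, D` until the column lengths are swapped
gives the columns `C', D'`. (If `C` and `D` have the same length, no slide is made.) -/
def SwapLengths {n : ℕ} (C D C' D' : Column n) : Prop :=
  (∃ j, SlidePath C D j C' D') ∧ C'.card = D.card ∧ D'.card = C.card

/-- `FirstColumn T X`: going through `T = C₁⋯C_k` from right to left, and swapping at each step the
lengths of the column `C_i` and of the leftmost column obtained before, one gets `X` as the leftmost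
column in the end. -/
inductive FirstColumn {n : ℕ} : List (Column n) → Column n → Prop
  | single (C : Column n) : FirstColumn [C] C
  | cons {C D X C' X' : Column n} {T : List (Column n)} (rest : FirstColumn (D :: T) X)
      (swap : SwapLengths C X C' X') : FirstColumn (C :: D :: T) C'

/-- `K` is the column `K₋¹(T)`, the last column of the left key of `T`, as computed by symplectic
jeu de taquin. -/
def IsLeftKeyColumn {n : ℕ} (T : List (Column n)) (K : Column n) : Prop :=
  ∃ X, FirstColumn T X ∧ K = leftCol X

/-! ### The direct way -/

/-- Match each of the given letters `β` in turn with the biggest not yet matched element `≤ β` of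
`R`; what is returned are the elements of `R` that remain unmatched. -/
def unmatchedAux {n : ℕ} : List (Letter n) → Finset (Letter n) → Finset (Letter n)
  | [], R => R
  | β :: βs, R =>
    if h : (R.filter (· ≤ β)).Nonempty then
      unmatchedAux βs (R.erase ((R.filter (· ≤ β)).max' h))
    else unmatchedAux βs R

/-- The unmatched elements of `R` in the matching between `R` (a right column) and `B` (a left
column), in which the elements of `B` are treated from the biggest to the smallest. -/
def unmatched {n : ℕ} (R B : Column n) : Column n := unmatchedAux (rows B).reverse R

/-- Starting in the given row of `L` and going up, the row of the first entry of `L` that is bigger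
than the entry directly Northeast of it (in `R`, one row higher); the top row if there is none. -/
def deletionRow {n : ℕ} (L R : List (Letter n)) : ℕ → ℕ
  | 0 => 0
  | p + 1 =>
    match L[p + 1]?, R[p]? with
    | some a, some b => if b < a then p + 1 else deletionRow L R p
    | _, _ => deletionRow L R p

/-- Treat one unmatched letter `β` of the right column `R`: delete the entry of the left column `L`
found by going up from the entry next to `β`, and delete `β` from `R`. In both columns the entries
below the deleted one move up by one row. -/
def deleteStep {n : ℕ} (LR : List (Letter n) × List (Letter n)) (β : Letter n) :
    List (Letter n) × List (Letter n) :=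
  (LR.1.eraseIdx (deletionRow LR.1 LR.2 (LR.2.idxOf β)), LR.2.erase β)

/-- What remains of `ℓC` after the deletions caused by the unmatched elements of `rC` in the
matching between `rC` and `B`, treated from the smallest to the biggest. -/
def deleteEntries {n : ℕ} (C B : Column n) : Column n :=
  ((rows (unmatched (rightCol C) B)).foldl deleteStep
    (rows (leftCol C), rows (rightCol C))).1.toFinset

/-- The column `ℓC₁'` obtained from `T = C₁⋯C_k` by the direct way: start with `ℓC_k`, and going
from right to left, form `ℓC_i'` from `C_i` and `ℓC_{i+1}'`. -/
def directLeft {n : ℕ} : List (Column n) → Column n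
  | [] => ∅
  | [C] => leftCol C
  | C :: D :: T => deleteEntries C (directLeft (D :: T))

end KN

namespace KN

/-! ### The involution and counting functions -/

/-! Everything is expressed through `cnt A x`, the number of letters of `A` at or behind the
position `x`. Positions run over `ℕ`, so the involution of the letters, `x ↦ 2n - 1 - x`, becomes
the reflection `x ↦ 2n - x` of positions.

For `L = ℓC`, `R = rC` the function `f = cnt L - cnt R` is at most `0`, is invariant under the
reflection, and vanishes at `0`, at `n` and at each letter missing from `L` together with its bar.
Such properties characterize the split forms of admissible columns (`Split`, `split_of_admissible`,
`Split.leftCol_rightCol_unsplit`). Hence slides can be performed on split pairs, and `Φ` need never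
be inverted explicitly.

Let `B, E` be the split form of the right column and `g = cnt R - cnt B`. Both algorithms compute
the unique `A` with `cnt L x - cnt A x = max (f y + g w)` over `x ≤ y ≤ w`; this is `KeyRel`.

For the direct way, the number of unmatched letters from `y` on is the maximum of `g w` over `w ≥ y`
(`runMax_unmatched`), and the number of deleted letters from `x` on is the maximum over `y ≥ x` of
`f y` plus the number of unmatched letters from `y` on (`foldl_deleteStep`).

For the jeu de taquin, when `s + 1` slides are left, the maximum of `g` is `s + 1`. The letter `b`
that moves is the last position where it is attained. It leaves `R` together with the letter `t` of
`L` at the last zero of `f` up to `b`, and enters `B` together with the letter `e` of `E`, the first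
letter from `b` on that is missing from `B` with its bar. A column `A` satisfying the relation after
the slide satisfies it before (`SlideState.keyRel_of_step`). After the last slide `f ≤ 0` and `g ≤
0`, so the relation holds with `A = L`. The invariants in `SlideState` guarantee that `b` and `e`
exist.

Finally `firstColumn_iff` iterates this over the columns. The new left column is contained in the
old one, which keeps `g` below the difference of the lengths. -/

theorem bar_val {n : ℕ} (x : Letter n) : (bar x).val = 2 * n - 1 - x.val := by
  have := x.isLt
  simp only [bar, Fin.val_rev]
  omega

@[simp] theorem bar_bar {n : ℕ} (x : Letter n) : bar (bar x) = x := Fin.rev_rev x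

theorem bar_inj {n : ℕ} {x y : Letter n} : bar x = bar y ↔ x = y := Fin.rev_inj

theorem bar_ne {n : ℕ} (x : Letter n) : bar x ≠ x := by
  intro h
  have h1 := congrArg Fin.val h
  rw [bar_val] at h1
  have := x.isLt
  omega

theorem unbarred_bar {n : ℕ} (x : Letter n) : Unbarred (bar x) ↔ ¬ Unbarred x := by
  have := x.isLt
  simp only [Unbarred, bar_val]
  omega

theorem mem_image_bar {n : ℕ} {A : Finset (Letter n)} {x : Letter n} :
    x ∈ A.image bar ↔ bar x ∈ A := by
  constructor
  · intro h
    obtain ⟨y, hy, rfl⟩ := Finset.mem_image.1 h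
    simpa using hy
  · intro h
    exact Finset.mem_image.2 ⟨bar x, h, bar_bar x⟩

/-- The number of letters of `A` that are at least `x`. -/
def cnt {n : ℕ} (A : Finset (Letter n)) (x : ℕ) : ℤ := ((A.filter fun a => x ≤ a.val).card : ℤ)

/-- The indicator of membership. -/
def ind {n : ℕ} (A : Finset (Letter n)) (a : Letter n) : ℤ := if a ∈ A then 1 else 0

theorem ind_of_mem {n : ℕ} {A : Finset (Letter n)} {a : Letter n} (h : a ∈ A) : ind A a = 1 :=
  if_pos h

theorem ind_of_notMem {n : ℕ} {A : Finset (Letter n)} {a : Letter n} (h : a ∉ A) : ind A a = 0 :=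
  if_neg h

theorem ind_nonneg {n : ℕ} (A : Finset (Letter n)) (a : Letter n) : 0 ≤ ind A a := by
  unfold ind; split_ifs <;> norm_num

theorem ind_le_one {n : ℕ} (A : Finset (Letter n)) (a : Letter n) : ind A a ≤ 1 := by
  unfold ind; split_ifs <;> norm_num

theorem cnt_nonneg {n : ℕ} (A : Finset (Letter n)) (x : ℕ) : 0 ≤ cnt A x := Int.natCast_nonneg _

theorem cnt_zero {n : ℕ} (A : Finset (Letter n)) : cnt A 0 = A.card := by simp [cnt]

@[simp] theorem cnt_empty {n : ℕ} (x : ℕ) : cnt (∅ : Finset (Letter n)) x = 0 := by simp [cnt]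

theorem cnt_of_le {n : ℕ} (A : Finset (Letter n)) {x : ℕ} (h : 2 * n ≤ x) : cnt A x = 0 := by
  simp only [cnt, Nat.cast_eq_zero, Finset.card_eq_zero]
  apply Finset.filter_false_of_mem
  intro a _
  have := a.isLt
  omega

theorem cnt_insert {n : ℕ} {A : Finset (Letter n)} {a : Letter n} (h : a ∉ A) (x : ℕ) :
    cnt (insert a A) x = cnt A x + if x ≤ a.val then 1 else 0 := by
  simp only [cnt, Finset.filter_insert]
  split_ifs
  · rw [Finset.card_insert_of_notMem (by simp [h])]; push_cast; ring
  · simp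

theorem cnt_erase {n : ℕ} {A : Finset (Letter n)} {a : Letter n} (h : a ∈ A) (x : ℕ) :
    cnt (A.erase a) x = cnt A x - if x ≤ a.val then 1 else 0 := by
  have := cnt_insert (Finset.notMem_erase a A) x
  rw [Finset.insert_erase h] at this
  omega

theorem cnt_union {n : ℕ} {A B : Finset (Letter n)} (h : Disjoint A B) (x : ℕ) :
    cnt (A ∪ B) x = cnt A x + cnt B x := by
  simp only [cnt, Finset.filter_union]
  rw [Finset.card_union_of_disjoint (Finset.disjoint_filter_filter h)]
  push_cast; ring

theorem cnt_sdiff {n : ℕ} {A B : Finset (Letter n)} (h : B ⊆ A) (x : ℕ) :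
    cnt (A \ B) x = cnt A x - cnt B x := by
  have := cnt_union (Finset.disjoint_sdiff (s := B) (t := A)) x
  rw [Finset.union_sdiff_of_subset h] at this
  omega

theorem cnt_succ {n : ℕ} (A : Finset (Letter n)) (a : Letter n) :
    cnt A a.val = cnt A (a.val + 1) + ind A a := by
  have key : ∀ B : Finset (Letter n), a ∉ B → cnt B a.val = cnt B (a.val + 1) := by
    intro B hB
    simp only [cnt]
    congr 2
    apply Finset.filter_congr
    intro y hy
    have : y.val ≠ a.val := fun h => hB (Fin.ext h ▸ hy)
    omega
  by_cases h : a ∈ A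
  · have h1 := cnt_erase h a.val
    have h2 := cnt_erase h (a.val + 1)
    have h3 := key _ (Finset.notMem_erase a A)
    rw [ind_of_mem h]
    simp at h1 h2
    omega
  · rw [ind_of_notMem h, key A h, add_zero]

theorem cnt_anti {n : ℕ} (A : Finset (Letter n)) {x y : ℕ} (h : x ≤ y) : cnt A y ≤ cnt A x := by
  simp only [cnt, Nat.cast_le]
  apply Finset.card_le_card
  intro a
  simp only [Finset.mem_filter]
  rintro ⟨h1, h2⟩
  exact ⟨h1, by omega⟩

theorem cnt_ext {n : ℕ} {A B : Finset (Letter n)} (h : ∀ x, cnt A x = cnt B x) : A = B := by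
  ext a
  have h1 := cnt_succ A a
  have h2 := cnt_succ B a
  have h3 := h a.val
  have h4 := h (a.val + 1)
  by_cases hA : a ∈ A <;> by_cases hB : a ∈ B <;> simp only [hA, hB] <;>
    simp only [ind, hA, hB, if_true, if_false] at h1 h2 <;> omega

/-- A letter `a` has its bar at or behind position `x` exactly when `a < 2n - x`; so the letters
counted are those before the reflected position. -/
theorem cnt_image_bar {n : ℕ} (A : Finset (Letter n)) (x : ℕ) (hx : x ≤ 2 * n) :
    cnt (A.image bar) x = cnt A 0 - cnt A (2 * n - x) := by
  induction A using Finset.induction_on with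
  | empty => simp
  | insert a A ha ih =>
    have ha' : bar a ∉ A.image bar := by rw [mem_image_bar, bar_bar]; exact ha
    rw [Finset.image_insert, cnt_insert ha', cnt_insert ha, cnt_insert ha, ih, bar_val]
    have := a.isLt
    split_ifs <;> omega

/-! ### Split columns -/

/-- The pairs `(ℓC, rC)`, where `C` is an admissible column, are characterized by these
properties. -/
structure Split {n : ℕ} (L R : Column n) : Prop where
  left : ∀ x ∈ L, bar x ∉ L
  right : ∀ x ∈ R, bar x ∉ R
  supp : ∀ x, (x ∈ L ∨ bar x ∈ L) ↔ (x ∈ R ∨ bar x ∈ R)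
  le : ∀ x, cnt L x ≤ cnt R x
  mid : cnt L n = cnt R n
  zero : ∀ x, Unbarred x → x ∉ L → bar x ∉ L → cnt L x.val = cnt R x.val

/-- The difference `cnt A k - cnt A (2n - k)` counts the letters in `[k, 2n - k)`. Passing from `k +
1` to `k` adjoins only the letter at `k` and its bar, and a column without pairs contains at most
one of them. -/
theorem cnt_fold {n : ℕ} (A : Column n) (h : ∀ x ∈ A, bar x ∉ A) (k : ℕ) (hk : k < n) :
    ∃ d : ℤ, (0 ≤ d ∧ d ≤ 1) ∧ cnt A k - cnt A (2 * n - k) =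
      cnt A (k + 1) - cnt A (2 * n - (k + 1)) + d ∧
      ∀ x : Letter n, (x.val = k ∨ x.val = 2 * n - 1 - k) → (d = 1 ↔ (x ∈ A ∨ bar x ∈ A)) := by
  let a : Letter n := ⟨k, by omega⟩
  have h1 := cnt_succ A a
  have h2 := cnt_succ A (bar a)
  rw [bar_val] at h2
  have e1 : 2 * n - 1 - a.val = 2 * n - (k + 1) := by simp only [a]; omega
  have e2 : 2 * n - (k + 1) + 1 = 2 * n - k := by omega
  rw [e1, e2] at h2
  have h3 := h a
  have hx : ∀ x : Letter n, (x.val = k ∨ x.val = 2 * n - 1 - k) → x = a ∨ x = bar a := by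
    rintro x (hx | hx)
    · left; exact Fin.ext hx
    · right; apply Fin.ext; rw [hx, bar_val]
  refine ⟨ind A a + ind A (bar a), ?_, ?_, ?_⟩
  · have := ind_nonneg A a
    have := ind_nonneg A (bar a)
    refine ⟨by omega, ?_⟩
    by_cases hA : a ∈ A
    · rw [ind_of_mem hA, ind_of_notMem (h3 hA)]; norm_num
    · rw [ind_of_notMem hA]; have := ind_le_one A (bar a); omega
  · have : a.val = k := rfl
    rw [this] at h1
    omega
  · intro x hx'
    have : (ind A a + ind A (bar a) = 1 ↔ (a ∈ A ∨ bar a ∈ A)) := by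
      by_cases hA : a ∈ A
      · simp [ind, hA, h3 hA]
      · simp [ind, hA]
    rw [this]
    rcases hx x hx' with rfl | rfl
    · rfl
    · rw [bar_bar]; tauto

/-- The number of letters of absolute value in `[k, m)` in a column without pairs. -/
theorem cnt_fold_le {n : ℕ} (A : Column n) (h : ∀ x ∈ A, bar x ∉ A) {k m : ℕ} (hkm : k ≤ m)
    (hm : m ≤ n) :
    cnt A m - cnt A (2 * n - m) ≤ cnt A k - cnt A (2 * n - k) ∧
    cnt A k - cnt A (2 * n - k) ≤ cnt A m - cnt A (2 * n - m) + (m - k) := by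
  induction m, hkm using Nat.le_induction with
  | base => simp
  | succ m hkm ih =>
    obtain ⟨d, hd, h1, -⟩ := cnt_fold A h m (by omega)
    have := ih (by omega)
    push_cast
    omega

theorem cnt_fold_full {n : ℕ} (A : Column n) (h : ∀ x ∈ A, bar x ∉ A) {k m : ℕ} (hkm : k ≤ m)
    (hm : m ≤ n) (hs : ∀ x : Letter n, k ≤ x.val → x.val < m → x ∈ A ∨ bar x ∈ A) :
    cnt A k - cnt A (2 * n - k) = cnt A m - cnt A (2 * n - m) + (m - k) := by
  induction m, hkm using Nat.le_induction with
  | base => simp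
  | succ m hkm ih =>
    obtain ⟨d, hd, h1, h2⟩ := cnt_fold A h m (by omega)
    have h3 := (h2 ⟨m, by omega⟩ (Or.inl rfl)).2 (hs _ hkm (by simp))
    have := ih (by omega) (fun x hx hx' => hs x hx (by omega))
    push_cast
    omega

/-! ### The symmetry of `f = cnt L - cnt R` for a split pair -/

theorem Split.fold {n : ℕ} {L R : Column n} (h : Split L R) {k m : ℕ} (hkm : k ≤ m)
    (hm : m ≤ n) :
    (cnt L k - cnt L (2 * n - k)) - (cnt L m - cnt L (2 * n - m)) =
    (cnt R k - cnt R (2 * n - k)) - (cnt R m - cnt R (2 * n - m)) := by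
  induction m, hkm using Nat.le_induction with
  | base => simp
  | succ m hkm ih =>
    obtain ⟨d, hd, h1, h2⟩ := cnt_fold L h.left m (by omega)
    obtain ⟨d', hd', h1', h2'⟩ := cnt_fold R h.right m (by omega)
    have h3 := h2 ⟨m, by omega⟩ (Or.inl rfl)
    have h3' := h2' ⟨m, by omega⟩ (Or.inl rfl)
    have h4 := h.supp ⟨m, by omega⟩
    have : d = 1 ↔ d' = 1 := by rw [h3, h3', h4]
    have := ih (by omega)
    omega

/-- `L` and `R` have the same absolute values, hence equally many letters in `[k, 2n - k)`. This is
the case `m = n` of `Split.fold`, where the folded counts vanish. -/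
theorem Split.symm_cnt {n : ℕ} {L R : Column n} (h : Split L R) {k : ℕ} (hk : k ≤ 2 * n) :
    cnt L k - cnt R k = cnt L (2 * n - k) - cnt R (2 * n - k) := by
  have e : 2 * n - n = n := by omega
  rcases le_total k n with hk' | hk'
  · have := h.fold hk' le_rfl
    rw [e] at this
    omega
  · have := h.fold (k := 2 * n - k) (m := n) (by omega) le_rfl
    have e' : 2 * n - (2 * n - k) = k := by omega
    rw [e, e'] at this
    omega

theorem Split.cnt_zero_eq {n : ℕ} {L R : Column n} (h : Split L R) : cnt L 0 = cnt R 0 := by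
  have := h.symm_cnt (k := 0) (by omega)
  have h1 := cnt_of_le L (x := 2 * n - 0) (by omega)
  have h2 := cnt_of_le R (x := 2 * n - 0) (by omega)
  omega

theorem Split.card_eq {n : ℕ} {L R : Column n} (h : Split L R) : L.card = R.card := by
  have := h.cnt_zero_eq
  rw [cnt_zero, cnt_zero] at this
  exact_mod_cast this

theorem Split.zero_all {n : ℕ} {L R : Column n} (h : Split L R) {x : Letter n} (h1 : x ∉ L)
    (h2 : bar x ∉ L) :
    cnt L x.val = cnt R x.val ∧ cnt L (x.val + 1) = cnt R (x.val + 1) := by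
  have h3 : ¬ (x ∈ R ∨ bar x ∈ R) := by rw [← h.supp]; tauto
  have hL := cnt_succ L x
  have hR := cnt_succ R x
  rw [ind_of_notMem h1] at hL
  rw [ind_of_notMem (by tauto)] at hR
  by_cases hx : Unbarred x
  · have := h.zero x hx h1 h2
    omega
  · have := h.zero (bar x) ((unbarred_bar x).2 hx) h2 (by rwa [bar_bar])
    have h4 := h.symm_cnt (k := (bar x).val) (by omega)
    have e : 2 * n - (bar x).val = x.val + 1 := by
      have := x.isLt
      rw [bar_val]; omega
    rw [e] at h4
    omega

/-! ### Reconstruction of a split pair from half of its letters -/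

theorem Split.mem_right_bar {n : ℕ} {L R : Column n} (h : Split L R) (x : Letter n) :
    x ∈ R ↔ (x ∈ L ∨ bar x ∈ L) ∧ bar x ∉ R := by
  have h1 := h.supp x
  have h2 := h.right x
  tauto

theorem Split.mem_left_bar {n : ℕ} {L R : Column n} (h : Split L R) (x : Letter n) :
    x ∈ L ↔ (x ∈ R ∨ bar x ∈ R) ∧ bar x ∉ L := by
  have h1 := h.supp x
  have h2 := h.left x
  tauto

/-- If `x` were in `L` but not in `L'`, it would be free in the second pair, so both differences
would vanish at `x + 1`. As `x ∉ R`, the first difference would be `1` at `x`, which is positive. -/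
theorem Split.unbarred_left_aux {n : ℕ} {L R L' R' : Column n} (h : Split L R)
    (h' : Split L' R') {x : Letter n} (hR : x ∈ R ↔ x ∈ R')
    (hL : bar x ∈ L ↔ bar x ∈ L')
    (hf : cnt L (x.val + 1) - cnt R (x.val + 1) = cnt L' (x.val + 1) - cnt R' (x.val + 1)) :
    x ∈ L → x ∈ L' := by
  intro h1
  by_contra h2
  have h3 := h.left x h1
  have h4 := (h'.zero_all h2 (by rwa [← hL])).2
  have h5 : x ∉ R' := by
    have := h'.supp x
    have : ¬ (x ∈ L' ∨ bar x ∈ L') := by rw [← hL]; tauto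
    tauto
  have h6 := cnt_succ L x
  have h7 := cnt_succ R x
  rw [ind_of_mem h1] at h6
  rw [ind_of_notMem (by tauto)] at h7
  have := h.le x.val
  omega

/-- The counterpart of `Split.unbarred_left_aux` in the other direction: the differences agree at
`x`, and a letter of `R` missing from `R'` would make the first one positive at `x + 1`. -/
theorem Split.unbarred_right_aux {n : ℕ} {L R L' R' : Column n} (h : Split L R)
    (h' : Split L' R') {x : Letter n} (hR : bar x ∈ R ↔ bar x ∈ R')
    (hL : x ∈ L ↔ x ∈ L')
    (hf : cnt L x.val - cnt R x.val = cnt L' x.val - cnt R' x.val) :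
    x ∈ R → x ∈ R' := by
  intro h1
  by_contra h2
  have h3 := h.right x h1
  have h5 : ¬ (x ∈ L' ∨ bar x ∈ L') := by
    rw [h'.supp]; tauto
  have h4 := (h'.zero_all (x := x) (by tauto) (by tauto)).1
  have h6 := cnt_succ L x
  have h7 := cnt_succ R x
  rw [ind_of_notMem (by tauto)] at h6
  rw [ind_of_mem h1] at h7
  have := h.le (x.val + 1)
  omega

/-- A split pair is determined by the unbarred part of the right column and the barred part of the
left column. -/
theorem Split.eq_of_column {n : ℕ} {L R L' R' : Column n} (h : Split L R) (h' : Split L' R')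
    (hR : ∀ x, Unbarred x → (x ∈ R ↔ x ∈ R')) (hL : ∀ x, ¬ Unbarred x → (x ∈ L ↔ x ∈ L')) :
    L = L' ∧ R = R' := by
  -- Induction from `n` downwards: there both differences vanish, and the known memberships
  -- determine one letter of `L` at a time.
  have key : ∀ d k : ℕ, k + d = n → cnt L k - cnt R k = cnt L' k - cnt R' k ∧
      ∀ x : Letter n, Unbarred x → k ≤ x.val → (x ∈ L ↔ x ∈ L') := by
    intro d
    induction d with
    | zero =>
      intro k hk
      have h1 := h.mid
      have h2 := h'.mid
      simp only [add_zero] at hk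
      subst hk
      refine ⟨by omega, fun x hx hx' => ?_⟩
      unfold Unbarred at hx
      omega
    | succ d ih =>
      intro k hk
      obtain ⟨h1, h2⟩ := ih (k + 1) (by omega)
      let a : Letter n := ⟨k, by omega⟩
      have ha : Unbarred a := by change k < n; omega
      have ha' : ¬ Unbarred (bar a) := by rw [unbarred_bar]; simpa using ha
      have hmem : a ∈ L ↔ a ∈ L' :=
        ⟨h.unbarred_left_aux h' (hR a ha) (hL _ ha') h1,
          h'.unbarred_left_aux h (hR a ha).symm (hL _ ha').symm h1.symm⟩
      constructor
      · have e1 : cnt L k = cnt L (k + 1) + ind L a := cnt_succ L a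
        have e2 : cnt R k = cnt R (k + 1) + ind R a := cnt_succ R a
        have e3 : cnt L' k = cnt L' (k + 1) + ind L' a := cnt_succ L' a
        have e4 : cnt R' k = cnt R' (k + 1) + ind R' a := cnt_succ R' a
        have e5 : ind L a = ind L' a := by unfold ind; simp only [hmem]
        have e6 : ind R a = ind R' a := by unfold ind; simp only [hR a ha]
        omega
      · intro x hx hx'
        rcases Nat.eq_or_lt_of_le hx' with h3 | h3
        · have : x = a := Fin.ext h3.symm
          rw [this, hmem]
        · exact h2 x hx h3
  have hLL : ∀ x, x ∈ L ↔ x ∈ L' := fun x => by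
    by_cases hx : Unbarred x
    · exact (key n 0 (by omega)).2 x hx (Nat.zero_le _)
    · exact hL x hx
  refine ⟨Finset.ext hLL, Finset.ext fun x => ?_⟩
  by_cases hx : Unbarred x
  · exact hR x hx
  · rw [h.mem_right_bar, h'.mem_right_bar, hLL, hLL, hR _ ((unbarred_bar x).2 hx)]

/-- A split pair is determined by the unbarred part of the left column and the barred part of the
right column. -/
theorem Split.eq_of_coadm {n : ℕ} {L R L' R' : Column n} (h : Split L R) (h' : Split L' R')
    (hL : ∀ x, Unbarred x → (x ∈ L ↔ x ∈ L')) (hR : ∀ x, ¬ Unbarred x → (x ∈ R ↔ x ∈ R')) :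
    L = L' ∧ R = R' := by
  -- Here the induction goes upwards from `0`, where both differences vanish as well.
  have key : ∀ k : ℕ, k ≤ n → cnt L k - cnt R k = cnt L' k - cnt R' k ∧
      ∀ x : Letter n, x.val < k → (x ∈ R ↔ x ∈ R') := by
    intro k
    induction k with
    | zero =>
      intro _
      have h1 := h.cnt_zero_eq
      have h2 := h'.cnt_zero_eq
      exact ⟨by omega, fun x hx => by omega⟩
    | succ k ih =>
      intro hk
      obtain ⟨h1, h2⟩ := ih (by omega)
      let a : Letter n := ⟨k, by omega⟩
      have ha : Unbarred a := by change k < n; omega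
      have ha' : ¬ Unbarred (bar a) := by rw [unbarred_bar]; simpa using ha
      have hmem : a ∈ R ↔ a ∈ R' :=
        ⟨h.unbarred_right_aux h' (hR _ ha') (hL a ha) h1,
          h'.unbarred_right_aux h (hR _ ha').symm (hL a ha).symm h1.symm⟩
      constructor
      · have e1 : cnt L k = cnt L (k + 1) + ind L a := cnt_succ L a
        have e2 : cnt R k = cnt R (k + 1) + ind R a := cnt_succ R a
        have e3 : cnt L' k = cnt L' (k + 1) + ind L' a := cnt_succ L' a
        have e4 : cnt R' k = cnt R' (k + 1) + ind R' a := cnt_succ R' a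
        have e5 : ind L a = ind L' a := by unfold ind; simp only [hL a ha]
        have e6 : ind R a = ind R' a := by unfold ind; simp only [hmem]
        omega
      · intro x hx
        rcases Nat.lt_succ_iff_lt_or_eq.1 hx with h3 | h3
        · exact h2 x h3
        · have : x = a := Fin.ext h3
          rw [this, hmem]
  have hRR : ∀ x, x ∈ R ↔ x ∈ R' := fun x => by
    by_cases hx : Unbarred x
    · exact (key n le_rfl).2 x hx
    · exact hR x hx
  refine ⟨Finset.ext fun x => ?_, Finset.ext hRR⟩
  by_cases hx : Unbarred x
  · exact hL x hx
  · rw [h.mem_left_bar, h'.mem_left_bar, hRR, hRR, hL _ ((unbarred_bar x).2 hx)]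

/-! ### The split form of an admissible column -/

/-- The unbarred letters that are absent from `C` together with their bars. -/
def gaps {n : ℕ} (C : Column n) : Finset (Letter n) :=
  Finset.univ.filter fun t => Unbarred t ∧ t ∉ C ∧ bar t ∉ C

theorem mem_gaps {n : ℕ} {C : Column n} {t : Letter n} :
    t ∈ gaps C ↔ Unbarred t ∧ t ∉ C ∧ bar t ∉ C := by simp [gaps]

theorem mem_pairs {n : ℕ} {C : Column n} {t : Letter n} :
    t ∈ pairs C ↔ t ∈ C ∧ Unbarred t ∧ bar t ∈ C := by simp [pairs]

/-- The part of `C` that lies outside of the interval between `k` and its bar has as many letters as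
there are unbarred letters before `k`, plus pairs, minus gaps. -/
theorem card_outside {n : ℕ} (C : Column n) (k : ℕ) (hk : k ≤ n) :
    cnt C 0 - cnt C k + cnt C (2 * n - k) =
      k + (cnt (pairs C) 0 - cnt (pairs C) k) - (cnt (gaps C) 0 - cnt (gaps C) k) := by
  induction k with
  | zero => simp [cnt_of_le]
  | succ k ih =>
    have ih := ih (by omega)
    let a : Letter n := ⟨k, by omega⟩
    have ha : Unbarred a := by change k < n; omega
    have e1 : cnt C k = cnt C (k + 1) + ind C a := cnt_succ C a
    have e2 := cnt_succ C (bar a)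
    have e3 : cnt (pairs C) k = cnt (pairs C) (k + 1) + ind (pairs C) a := cnt_succ _ a
    have e4 : cnt (gaps C) k = cnt (gaps C) (k + 1) + ind (gaps C) a := cnt_succ _ a
    have e5 : (bar a).val = 2 * n - (k + 1) := by rw [bar_val]; simp only [a]; omega
    have e6 : 2 * n - (k + 1) + 1 = 2 * n - k := by omega
    rw [e5, e6] at e2
    have e7 : ind C a + ind C (bar a) = 1 + ind (pairs C) a - ind (gaps C) a := by
      unfold ind
      simp only [mem_gaps, mem_pairs]
      by_cases h1 : a ∈ C <;> by_cases h2 : bar a ∈ C <;> simp [h1, h2, ha]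
    push_cast
    omega

theorem card_filter_outside {n : ℕ} (C : Column n) (z : Letter n) (hz : Unbarred z) :
    ((C.filter fun x => x ≤ z ∨ bar z ≤ x).card : ℤ) =
      cnt C 0 - cnt C (z.val + 1) + cnt C (2 * n - (z.val + 1)) := by
  have e : C.filter (fun x => x ≤ z ∨ bar z ≤ x) =
      (C \ C.filter fun x => z.val + 1 ≤ x.val) ∪ C.filter fun x => 2 * n - (z.val + 1) ≤ x.val := by
    ext x
    simp only [Finset.mem_filter, Finset.mem_union, Finset.mem_sdiff, Fin.le_def, bar_val]
    have : 2 * n - 1 - z.val = 2 * n - (z.val + 1) := by omega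
    rw [this]
    by_cases hx : x ∈ C <;> simp [hx]
  have hd : Disjoint (C \ C.filter fun x => z.val + 1 ≤ x.val)
      (C.filter fun x => 2 * n - (z.val + 1) ≤ x.val) := by
    rw [Finset.disjoint_left]
    intro x h1 h2
    simp only [Finset.mem_filter, Finset.mem_sdiff] at h1 h2
    unfold Unbarred at hz
    have : ¬ z.val + 1 ≤ x.val := fun h => h1.2 ⟨h1.1, h⟩
    omega
  rw [e, Finset.card_union_of_disjoint hd]
  have h1 := Finset.card_sdiff_add_card_eq_card
    (Finset.filter_subset (fun x : Letter n => z.val + 1 ≤ x.val) C)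
  have h2 := cnt_zero C
  have h3 : cnt C (z.val + 1) = ((C.filter fun x => z.val + 1 ≤ x.val).card : ℤ) := rfl
  have h4 : cnt C (2 * n - (z.val + 1)) =
    ((C.filter fun x => 2 * n - (z.val + 1) ≤ x.val).card : ℤ) := rfl
  push_cast
  omega

/-- By `card_outside` the number bounded in the definition is `z + 1` plus pairs minus gaps.
Admissibility is thus a ballot condition: up to each pair there are at least as many gaps as pairs,
which is what the greedy choice of the `t_i` needs. -/
theorem admissible_iff {n : ℕ} (C : Column n) : Admissible C ↔ ∀ z ∈ pairs C,
    cnt (pairs C) 0 - cnt (pairs C) (z.val + 1) ≤ cnt (gaps C) 0 - cnt (gaps C) (z.val + 1) := by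
  have key : ∀ z : Letter n, Unbarred z →
      ((C.filter fun x => x ≤ z ∨ bar z ≤ x).card ≤ z.val + 1 ↔
      cnt (pairs C) 0 - cnt (pairs C) (z.val + 1) ≤
        cnt (gaps C) 0 - cnt (gaps C) (z.val + 1)) := by
    intro z hz
    have h1 := card_filter_outside C z hz
    have h2 := card_outside C (z.val + 1) hz
    push_cast at h2
    constructor <;> intro h3 <;> omega
  constructor
  · intro h z hz
    obtain ⟨h1, h2, h3⟩ := mem_pairs.1 hz
    exact (key z h2).1 (h z h1 h2 h3)
  · intro h z h1 h2 h3
    exact (key z h2).2 (h z (mem_pairs.2 ⟨h1, h2, h3⟩))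

/-- The choices made so far, when the pairs in `P` have been treated and `J` has been chosen. -/
structure PartialSplit {n : ℕ} (C : Column n) (P J : Finset (Letter n)) : Prop where
  sub : J ⊆ gaps C
  card : cnt J 0 = cnt P 0
  le : ∀ k, cnt J k ≤ cnt P k
  zero : ∀ k ∈ gaps C, k ∉ J → cnt J k.val = cnt P k.val

/-! ### Success of the greedy choice of the letters `t_i` -/

theorem cnt_full {n : ℕ} {A : Finset (Letter n)} {k : ℕ} (h : cnt A k = cnt A 0) {s : Letter n}
    (hs : s ∈ A) : k ≤ s.val := by
  by_contra hk
  have h1 := cnt_succ A s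
  have h2 := cnt_anti A (x := s.val + 1) (y := k) (by omega)
  have h3 := cnt_anti A (x := 0) (y := s.val) (by omega)
  rw [ind_of_mem hs] at h1
  omega

theorem cnt_eq_of_forall {n : ℕ} {A : Finset (Letter n)} {k : ℕ} (h : ∀ s ∈ A, k ≤ s.val) :
    cnt A k = cnt A 0 := by
  simp only [cnt]
  congr 2
  apply Finset.filter_congr
  intro s hs
  have := h s hs
  omega

theorem mem_splitCandidates {n : ℕ} {C : Column n} {z : Letter n} {J : Finset (Letter n)}
    {t : Letter n} : t ∈ splitCandidates C z J ↔ t ∈ gaps C ∧ t < z ∧ ∀ s ∈ J, t < s := by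
  simp only [splitCandidates, mem_gaps, Finset.mem_filter, Finset.mem_univ, true_and]
  tauto

/-- If there is no candidate for `z`, a suitable initial segment has all its gaps already used,
while it contains `z` in addition to the pairs of `P` that paid for these gaps. This violates the
ballot condition at the last letter of the segment. -/
theorem PartialSplit.candidates {n : ℕ} {C : Column n} (hC : Admissible C)
    {P J : Finset (Letter n)} (h : PartialSplit C P J) (hP : P ⊆ pairs C) {z : Letter n}
    (hz : z ∈ pairs C) (hzP : ∀ p ∈ P, z < p) : (splitCandidates C z J).Nonempty := by
  by_contra hne
  rw [Finset.not_nonempty_iff_eq_empty] at hne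
  have hno : ∀ t ∈ gaps C, t < z → ∃ s ∈ J, s ≤ t := by
    intro t ht htz
    by_contra hcon
    push Not at hcon
    have : t ∈ splitCandidates C z J := mem_splitCandidates.2 ⟨ht, htz, hcon⟩
    rw [hne] at this
    simp at this
  have hzn : z.val < n := (mem_pairs.1 hz).2.1
  have hex : ∃ k, z.val < k ∧ cnt J k = cnt P k :=
    ⟨2 * n, by omega, by rw [cnt_of_le _ le_rfl, cnt_of_le _ le_rfl]⟩
  -- `k` is the end of the segment: the first position behind `z` where `J` and `P` have equally
  -- many letters left. By minimality its last letter `k - 1` is `z` or a letter of `P`.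
  obtain ⟨k, ⟨hk1, hk2⟩, hmin⟩ : ∃ k, (z.val < k ∧ cnt J k = cnt P k) ∧
      ∀ m < k, ¬ (z.val < m ∧ cnt J m = cnt P m) := by
    classical
    exact ⟨Nat.find hex, Nat.find_spec hex, fun m => Nat.find_min hex⟩
  have hkle : k ≤ 2 * n := by
    by_contra hcon
    exact hmin (2 * n) (by omega) ⟨by omega, by rw [cnt_of_le _ le_rfl, cnt_of_le _ le_rfl]⟩
  let y : Letter n := ⟨k - 1, by omega⟩
  have hy : y.val + 1 = k := by simp only [y]; omega
  have hzy : z ≤ y := by rw [Fin.le_def]; omega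
  have hyP : y ∈ insert z P := by
    rcases eq_or_lt_of_le hzy with h1 | h1
    · rw [h1]; exact Finset.mem_insert_self _ _
    · apply Finset.mem_insert_of_mem
      by_contra h2
      have h3 := hmin y.val (by omega)
      rw [Fin.lt_def] at h1
      have h4 := cnt_succ P y
      have h5 := cnt_succ J y
      rw [ind_of_notMem h2] at h4
      rw [hy] at h4 h5
      have h6 := ind_nonneg J y
      have h7 := h.le y.val
      exact h3 ⟨h1, by omega⟩
  have hins : insert z P ⊆ pairs C := Finset.insert_subset hz hP
  have h1 := (admissible_iff C).1 hC y (hins hyP)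
  rw [hy] at h1
  -- An unused gap before `z` would be a candidate, and an unused gap between `z` and `k` would be
  -- an earlier position of equality.
  have hgap : ∀ t ∈ gaps C, t.val < k → t ∈ J := by
    intro t ht htk
    by_contra htJ
    have h2 := h.zero t ht htJ
    rcases lt_trichotomy t.val z.val with h3 | h3 | h3
    · obtain ⟨s, hs, hst⟩ := hno t ht h3
      have h4 : cnt P t.val = cnt P 0 := cnt_eq_of_forall fun p hp => by
        have := hzP p hp
        rw [Fin.lt_def] at this; omega
      have h5 := cnt_full (A := J) (k := t.val) (by rw [h2, h4, h.card]) hs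
      have : s = t := le_antisymm hst h5
      exact htJ (this ▸ hs)
    · have : t = z := Fin.ext h3
      rw [this] at ht
      exact (mem_gaps.1 ht).2.1 (mem_pairs.1 hz).1
    · exact hmin _ htk ⟨h3, h2⟩
  have h2 : cnt (gaps C \ J) k = cnt (gaps C \ J) 0 := cnt_eq_of_forall fun s hs => by
    by_contra hcon
    rw [Finset.mem_sdiff] at hs
    exact hs.2 (hgap s hs.1 (by omega))
  rw [cnt_sdiff h.sub, cnt_sdiff h.sub] at h2
  have hzP' : z ∉ P := fun hzz => lt_irrefl _ (hzP z hzz)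
  have h3 := cnt_nonneg (pairs C \ insert z P) k
  have h4 := cnt_anti (pairs C \ insert z P) (x := 0) (y := k) (by omega)
  rw [cnt_sdiff hins, cnt_sdiff hins, cnt_insert hzP', cnt_insert hzP', if_neg (by omega),
    if_pos (by omega)] at h4
  have h5 := h.card
  omega

theorem PartialSplit.step {n : ℕ} {C : Column n} {P J : Finset (Letter n)}
    (h : PartialSplit C P J) {z : Letter n}
    (hz : z ∈ pairs C) (hzP : ∀ p ∈ P, z < p) (hne : (splitCandidates C z J).Nonempty) :
    PartialSplit C (insert z P) (insert ((splitCandidates C z J).max' hne) J) := by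
  have ht := Finset.max'_mem _ hne
  have hmax : ∀ s ∈ splitCandidates C z J, s ≤ (splitCandidates C z J).max' hne :=
    fun s => Finset.le_max' (splitCandidates C z J) s
  generalize (splitCandidates C z J).max' hne = t at ht hmax
  obtain ⟨ht1, ht2, ht3⟩ := mem_splitCandidates.1 ht
  have htJ : t ∉ J := fun h1 => lt_irrefl _ (ht3 t h1)
  have hzP' : z ∉ P := fun hzz => lt_irrefl _ (hzP z hzz)
  rw [Fin.lt_def] at ht2
  refine ⟨Finset.insert_subset ht1 h.sub, ?_, ?_, ?_⟩
  · rw [cnt_insert htJ, cnt_insert hzP', h.card]; simp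
  · intro k
    rw [cnt_insert htJ, cnt_insert hzP']
    have := h.le k
    split_ifs <;> omega
  · intro k hk hkJ
    rw [Finset.mem_insert, not_or] at hkJ
    rw [cnt_insert htJ, cnt_insert hzP']
    have h1 := h.zero k hk hkJ.2
    have hkt : k.val ≠ t.val := fun e => hkJ.1 (Fin.ext e)
    have hkz : k.val ≠ z.val := fun e => by
      rw [Fin.ext e] at hk
      exact (mem_gaps.1 hk).2.1 (mem_pairs.1 hz).1
    -- A gap `k` between `t` and `z` was no candidate although it exceeds the greatest one, so some
    -- element of `J` is at most `k`. But `zero` at `k` puts all of `J` at or behind `k`, so `k`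
    -- itself is in `J`.
    have : ¬ (t.val < k.val ∧ k.val < z.val) := by
      rintro ⟨h2, h3⟩
      have h4 : k ∉ splitCandidates C z J := fun h4 => by
        have := hmax k h4
        rw [Fin.le_def] at this
        omega
      rw [mem_splitCandidates] at h4
      have h5 : ∃ s ∈ J, s ≤ k := by
        by_contra hcon
        push Not at hcon
        exact h4 ⟨hk, h3, hcon⟩
      obtain ⟨s, hs, hsk⟩ := h5
      have h6 : cnt P k.val = cnt P 0 := cnt_eq_of_forall fun p hp => by
        have := hzP p hp
        rw [Fin.lt_def] at this; omega
      have h5 := cnt_full (A := J) (k := k.val) (by rw [h1, h6, h.card]) hs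
      have : s = k := le_antisymm hsk h5
      exact hkJ.2 (this ▸ hs)
    split_ifs <;> omega

theorem partialSplit_splitAux {n : ℕ} {C : Column n} (hC : Admissible C) (zs : List (Letter n)) :
    ∀ {P J : Finset (Letter n)}, PartialSplit C P J → P ⊆ pairs C → (∀ z ∈ zs, z ∈ pairs C) →
      zs.Pairwise (· > ·) → (∀ z ∈ zs, ∀ p ∈ P, z < p) →
      PartialSplit C (P ∪ zs.toFinset) (splitAux C zs J) := by
  induction zs with
  | nil => intro P J h _ _ _ _; simpa [splitAux] using h
  | cons z zs ih =>
    intro P J h hP hzs hsort hlt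
    have hz : z ∈ pairs C := hzs z List.mem_cons_self
    have hzP : ∀ p ∈ P, z < p := hlt z List.mem_cons_self
    have hne := h.candidates hC hP hz hzP
    rw [splitAux, dif_pos hne]
    have e : P ∪ (z :: zs).toFinset = insert z P ∪ zs.toFinset := by
      ext x; simp only [Finset.mem_union, List.mem_toFinset, List.mem_cons, Finset.mem_insert]; tauto
    rw [e]
    rw [List.pairwise_cons] at hsort
    refine ih (h.step hz hzP hne) (Finset.insert_subset hz hP)
      (fun y hy => hzs y (List.mem_cons_of_mem _ hy)) hsort.2 ?_
    intro y hy p hp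
    rcases Finset.mem_insert.1 hp with rfl | hp
    · exact hsort.1 y hy
    · exact hlt y (List.mem_cons_of_mem _ hy) p hp

theorem mem_rows {n : ℕ} {C : Column n} {x : Letter n} : x ∈ rows C ↔ x ∈ C := by simp [rows]

theorem rows_pairwise {n : ℕ} (C : Column n) : (rows C).Pairwise (· < ·) :=
  (Finset.sortedLT_sort C).pairwise

theorem partialSplit_splitSet {n : ℕ} {C : Column n} (hC : Admissible C) :
    PartialSplit C (pairs C) (splitSet C) := by
  have h0 : PartialSplit C ∅ ∅ := ⟨by simp, by simp, by simp, by simp⟩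
  have := partialSplit_splitAux hC (rows (pairs C)).reverse h0 (by simp)
    (by simp [mem_rows]) (by rw [List.pairwise_reverse]; exact rows_pairwise _) (by simp)
  have e : ∅ ∪ (rows (pairs C)).reverse.toFinset = pairs C := by
    ext x; simp [mem_rows]
  rw [e] at this
  exact this

theorem mem_leftCol {n : ℕ} {C : Column n} {x : Letter n} :
    x ∈ leftCol C ↔ (x ∈ C ∧ x ∉ pairs C) ∨ x ∈ splitSet C := by
  simp [leftCol]

theorem mem_rightCol {n : ℕ} {C : Column n} {x : Letter n} :
    x ∈ rightCol C ↔ (x ∈ C ∧ bar x ∉ pairs C) ∨ bar x ∈ splitSet C := by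
  simp only [rightCol, Finset.mem_union, Finset.mem_sdiff, mem_image_bar]

/-- With `d = cnt (splitSet C) - cnt (pairs C)` one has `f k = d k + d (2n - k)`, so the counting
conditions follow from `PartialSplit` and from the fact that `d` vanishes from `n` on. -/
theorem split_of_admissible {n : ℕ} {C : Column n} (hC : Admissible C) :
    Split (leftCol C) (rightCol C) := by
  have h := partialSplit_splitSet hC
  have hJ : ∀ x ∈ splitSet C, Unbarred x ∧ x ∉ C ∧ bar x ∉ C := fun x hx => mem_gaps.1 (h.sub hx)
  have hbar : ∀ x : Letter n, Unbarred (bar x) ↔ ¬ Unbarred x := unbarred_bar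
  have hpb : (pairs C).image bar ⊆ C := fun x hx => by
    rw [mem_image_bar, mem_pairs, bar_bar] at hx; exact hx.2.2
  have hcL : ∀ k, cnt (leftCol C) k = cnt C k - cnt (pairs C) k + cnt (splitSet C) k := by
    intro k
    rw [leftCol, cnt_union, cnt_sdiff (show pairs C ⊆ C from Finset.filter_subset _ _)]
    rw [Finset.disjoint_left]
    intro x hx hx'
    exact (hJ x hx').2.1 (Finset.mem_sdiff.1 hx).1
  have hcR : ∀ k, k ≤ 2 * n → cnt (rightCol C) k = cnt C k -
      (cnt (pairs C) 0 - cnt (pairs C) (2 * n - k)) +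
      (cnt (splitSet C) 0 - cnt (splitSet C) (2 * n - k)) := by
    intro k hk
    rw [rightCol, cnt_union, cnt_sdiff hpb, cnt_image_bar _ _ hk, cnt_image_bar _ _ hk]
    rw [Finset.disjoint_left]
    intro x hx hx'
    rw [mem_image_bar] at hx'
    have := (hJ _ hx').2.2
    rw [bar_bar] at this
    exact this (Finset.mem_sdiff.1 hx).1
  have hP0 : ∀ k, n ≤ k → cnt (pairs C) k = 0 ∧ cnt (splitSet C) k = 0 := by
    intro k hk
    have : cnt (pairs C) k = 0 := by
      simp only [cnt, Nat.cast_eq_zero, Finset.card_eq_zero]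
      apply Finset.filter_false_of_mem
      intro x hx
      have : x.val < n := (mem_pairs.1 hx).2.1
      omega
    have h1 := h.le k
    have h2 := cnt_nonneg (splitSet C) k
    exact ⟨this, by omega⟩
  have hcard := h.card
  refine ⟨?_, ?_, ?_, ?_, ?_, ?_⟩
  · intro x
    simp only [mem_leftCol, mem_pairs, bar_bar]
    have h1 := hJ x
    have h2 := hJ (bar x)
    have h3 := hbar x
    rw [bar_bar] at h2
    tauto
  · intro x
    simp only [mem_rightCol, mem_pairs, bar_bar]
    have h1 := hJ x
    have h2 := hJ (bar x)
    have h3 := hbar x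
    rw [bar_bar] at h2
    tauto
  · intro x
    simp only [mem_leftCol, mem_rightCol, mem_pairs, bar_bar]
    have h1 := hJ x
    have h2 := hJ (bar x)
    have h3 := hbar x
    rw [bar_bar] at h2
    clear hcL hcR hP0 hJ hbar hpb hcard h
    by_cases h4 : x ∈ splitSet C <;> by_cases h5 : bar x ∈ splitSet C <;>
      by_cases h6 : x ∈ C <;> by_cases h7 : bar x ∈ C <;> by_cases h8 : Unbarred x <;>
      simp_all
  · intro k
    rcases le_total k (2 * n) with hk | hk
    · rw [hcL, hcR k hk]
      have h1 := h.le k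
      have h2 := h.le (2 * n - k)
      omega
    · rw [cnt_of_le _ hk, cnt_of_le _ hk]
  · have e : 2 * n - n = n := by omega
    have := hP0 n le_rfl
    rw [hcL, hcR n (by omega), e]
    omega
  · intro x hx h1 h2
    have hxn : x.val < n := hx
    have h3 : x ∈ gaps C := by
      simp only [mem_leftCol, mem_pairs, bar_bar] at h1 h2
      have h3 := hbar x
      rw [mem_gaps]
      tauto
    have h4 : x ∉ splitSet C := fun h4 => h1 (mem_leftCol.2 (Or.inr h4))
    have h5 := h.zero x h3 h4
    have h6 := hP0 (2 * n - x.val) (by omega)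
    rw [hcL, hcR _ (by omega)]
    omega

theorem mem_leftCol_of_barred {n : ℕ} {C : Column n} (hC : Admissible C) {x : Letter n}
    (hx : ¬ Unbarred x) : x ∈ leftCol C ↔ x ∈ C := by
  have := fun h => mem_gaps.1 ((partialSplit_splitSet hC).sub (x := x) h)
  rw [mem_leftCol, mem_pairs]
  tauto

theorem mem_rightCol_of_unbarred {n : ℕ} {C : Column n} (hC : Admissible C) {x : Letter n}
    (hx : Unbarred x) : x ∈ rightCol C ↔ x ∈ C := by
  have := fun h => mem_gaps.1 ((partialSplit_splitSet hC).sub (x := bar x) h)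
  have h3 := unbarred_bar x
  rw [mem_rightCol, mem_pairs]
  tauto

/-- The column with the given split form. -/
def unsplit {n : ℕ} (L R : Column n) : Column n :=
  R.filter (fun x => Unbarred x) ∪ L.filter (fun x => ¬ Unbarred x)

theorem mem_unsplit {n : ℕ} {L R : Column n} {x : Letter n} :
    x ∈ unsplit L R ↔ (x ∈ R ∧ Unbarred x) ∨ (x ∈ L ∧ ¬ Unbarred x) := by
  simp [unsplit]

theorem mem_coadm {n : ℕ} {C : Column n} {x : Letter n} :
    x ∈ coadm C ↔ (x ∈ leftCol C ∧ Unbarred x) ∨ (x ∈ rightCol C ∧ ¬ Unbarred x) := by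
  simp [coadm]

theorem unsplit_leftCol_rightCol {n : ℕ} {C : Column n} (hC : Admissible C) :
    unsplit (leftCol C) (rightCol C) = C := by
  ext x
  rw [mem_unsplit]
  by_cases hx : Unbarred x
  · simp [hx, mem_rightCol_of_unbarred hC hx]
  · simp [hx, mem_leftCol_of_barred hC hx]

/-- The excess of pairs over gaps before position `k` is at most `f k`, by comparing increments
letter by letter; and `f ≤ 0`. -/
theorem Split.admissible {n : ℕ} {L R : Column n} (h : Split L R) : Admissible (unsplit L R) := by
  rw [admissible_iff]
  intro z _
  have key : ∀ k : ℕ, k ≤ n →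
      cnt (pairs (unsplit L R)) 0 - cnt (pairs (unsplit L R)) k -
      (cnt (gaps (unsplit L R)) 0 - cnt (gaps (unsplit L R)) k) ≤ cnt L k - cnt R k := by
    intro k
    induction k with
    | zero => intro _; have := h.cnt_zero_eq; omega
    | succ k ih =>
      intro hk
      have ih := ih (by omega)
      let a : Letter n := ⟨k, by omega⟩
      have ha : Unbarred a := by change k < n; omega
      have ha' : ¬ Unbarred (bar a) := by rw [unbarred_bar]; simpa using ha
      have e1 : cnt L k = cnt L (k + 1) + ind L a := cnt_succ L a
      have e2 : cnt R k = cnt R (k + 1) + ind R a := cnt_succ R a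
      have e3 : cnt (pairs (unsplit L R)) k = cnt (pairs (unsplit L R)) (k + 1) +
        ind (pairs (unsplit L R)) a := cnt_succ _ a
      have e4 : cnt (gaps (unsplit L R)) k = cnt (gaps (unsplit L R)) (k + 1) +
        ind (gaps (unsplit L R)) a := cnt_succ _ a
      have e5 : ind (pairs (unsplit L R)) a - ind (gaps (unsplit L R)) a ≤ ind R a - ind L a := by
        unfold ind
        simp only [mem_gaps, mem_pairs, mem_unsplit, ha, ha', true_and, and_true]
        have h1 := h.left a
        have h2 := h.right a
        have h3 := h.supp a
        by_cases h4 : a ∈ L <;> by_cases h5 : a ∈ R <;> by_cases h6 : bar a ∈ L <;>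
          by_cases h7 : bar a ∈ R <;> simp_all
      omega
  by_cases hz : z.val + 1 ≤ n
  · have h1 := key _ hz
    have h2 := h.le (z.val + 1)
    omega
  · rename_i hz'
    have : z.val < n := (mem_pairs.1 hz').2.1
    omega

/-- Together with `split_of_admissible` this identifies admissible columns with split pairs. -/
theorem Split.leftCol_rightCol_unsplit {n : ℕ} {L R : Column n} (h : Split L R) :
    leftCol (unsplit L R) = L ∧ rightCol (unsplit L R) = R := by
  apply (split_of_admissible h.admissible).eq_of_column h
  · intro x hx
    rw [mem_rightCol_of_unbarred h.admissible hx, mem_unsplit]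
    tauto
  · intro x hx
    rw [mem_leftCol_of_barred h.admissible hx, mem_unsplit]
    tauto

theorem coadm_injective {n : ℕ} {C D : Column n} (hC : Admissible C) (hD : Admissible D)
    (h : coadm C = coadm D) : C = D := by
  have h1 := (split_of_admissible hC).eq_of_coadm (split_of_admissible hD)
    (fun x hx => by
      have : x ∈ coadm C ↔ x ∈ coadm D := by rw [h]
      simp only [mem_coadm] at this
      tauto)
    (fun x hx => by
      have : x ∈ coadm C ↔ x ∈ coadm D := by rw [h]
      simp only [mem_coadm] at this
      tauto)
  rw [← unsplit_leftCol_rightCol hC, ← unsplit_leftCol_rightCol hD, h1.1, h1.2]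

theorem card_leftCol {n : ℕ} {C : Column n} (hC : Admissible C) : (leftCol C).card = C.card := by
  have h := split_of_admissible hC
  have h1 := partialSplit_splitSet hC
  have h2 : cnt (leftCol C) 0 = cnt C 0 - cnt (pairs C) 0 + cnt (splitSet C) 0 := by
    rw [leftCol, cnt_union, cnt_sdiff (show pairs C ⊆ C from Finset.filter_subset _ _)]
    rw [Finset.disjoint_left]
    intro x hx hx'
    exact (mem_gaps.1 (h1.sub hx')).2.1 (Finset.mem_sdiff.1 hx).1
  have h3 := h1.card
  rw [cnt_zero, cnt_zero] at h2
  omega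

theorem card_rightCol {n : ℕ} {C : Column n} (hC : Admissible C) : (rightCol C).card = C.card := by
  rw [← (split_of_admissible hC).card_eq, card_leftCol hC]

/-! ### Removing a letter from, or adding a letter to, a split column -/

/-! ### Membership bookkeeping for an involution, used for `removeRight` and `addLeft` -/

section Involution

variable {α : Type*} {σ : α → α}

theorem no_pair_remove (hσ : ∀ x, σ (σ x) = x) (hne : ∀ x, σ x ≠ x) {R : α → Prop} {b t : α}
    (h : ∀ x, R x → ¬ R (σ x)) {x : α}
    (hx : (t = b ∧ x ≠ b ∧ R x) ∨ (t ≠ b ∧ (x = σ b ∨ (x ≠ σ t ∧ x ≠ b ∧ R x))))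
    (hx' : (t = b ∧ σ x ≠ b ∧ R (σ x)) ∨
      (t ≠ b ∧ (σ x = σ b ∨ (σ x ≠ σ t ∧ σ x ≠ b ∧ R (σ x))))) : False := by
  grind

theorem supp_remove (hσ : ∀ x, σ (σ x) = x) {L R : α → Prop} {b t : α}
    (hL : ∀ x, L x → ¬ L (σ x)) (hR : ∀ x, R x → ¬ R (σ x))
    (h : ∀ x, L x ∨ L (σ x) ↔ R x ∨ R (σ x)) (hb : R b) (ht : L t) (htR : t ≠ b → ¬ R t)
    (htb : σ t ≠ b) (x : α) :
    (x ≠ t ∧ L x) ∨ (σ x ≠ t ∧ L (σ x)) ↔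
      ((t = b ∧ x ≠ b ∧ R x) ∨ (t ≠ b ∧ (x = σ b ∨ (x ≠ σ t ∧ x ≠ b ∧ R x)))) ∨
      ((t = b ∧ σ x ≠ b ∧ R (σ x)) ∨
        (t ≠ b ∧ (σ x = σ b ∨ (σ x ≠ σ t ∧ σ x ≠ b ∧ R (σ x))))) := by
  have h1 := h x
  have h2 := h t
  have h3 := h b
  grind

theorem no_pair_add (hσ : ∀ x, σ (σ x) = x) (hne : ∀ x, σ x ≠ x) {B : α → Prop} {b e : α}
    (h : ∀ x, B x → ¬ B (σ x)) (he : ¬ B e ∧ ¬ B (σ e)) {x : α}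
    (hx : (e = b ∧ (x = b ∨ B x)) ∨ (e ≠ b ∧ (x = σ e ∨ x = b ∨ (x ≠ σ b ∧ B x))))
    (hx' : (e = b ∧ (σ x = b ∨ B (σ x))) ∨
      (e ≠ b ∧ (σ x = σ e ∨ σ x = b ∨ (σ x ≠ σ b ∧ B (σ x))))) : False := by
  grind

theorem supp_add (hσ : ∀ x, σ (σ x) = x) {B E : α → Prop} {b e : α}
    (h : ∀ x, B x ∨ B (σ x) ↔ E x ∨ E (σ x)) (hb : e ≠ b → B (σ b)) (x : α) :
    ((e = b ∧ (x = b ∨ B x)) ∨ (e ≠ b ∧ (x = σ e ∨ x = b ∨ (x ≠ σ b ∧ B x)))) ∨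
      ((e = b ∧ (σ x = b ∨ B (σ x))) ∨
        (e ≠ b ∧ (σ x = σ e ∨ σ x = b ∨ (σ x ≠ σ b ∧ B (σ x))))) ↔
      (x = e ∨ E x) ∨ (σ x = e ∨ E (σ x)) := by
  have h1 := h x
  have h2 := h b
  grind

theorem free_of_add (hσ : ∀ x, σ (σ x) = x) {B : α → Prop} {b e x : α}
    (h1 : ¬ ((e = b ∧ (x = b ∨ B x)) ∨ (e ≠ b ∧ (x = σ e ∨ x = b ∨ (x ≠ σ b ∧ B x)))))
    (h2 : ¬ ((e = b ∧ (σ x = b ∨ B (σ x))) ∨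
      (e ≠ b ∧ (σ x = σ e ∨ σ x = b ∨ (σ x ≠ σ b ∧ B (σ x)))))) :
    (¬ B x ∧ ¬ B (σ x)) ∧ x ≠ e ∧ σ x ≠ e := by
  grind

end Involution

/-- The coadmissible column with the given split form. -/
def cosplit {n : ℕ} (L R : Column n) : Column n :=
  L.filter (fun x => Unbarred x) ∪ R.filter (fun x => ¬ Unbarred x)

theorem mem_cosplit {n : ℕ} {L R : Column n} {x : Letter n} :
    x ∈ cosplit L R ↔ (x ∈ L ∧ Unbarred x) ∨ (x ∈ R ∧ ¬ Unbarred x) := by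
  simp [cosplit]

theorem Split.coadm_unsplit {n : ℕ} {L R : Column n} (h : Split L R) :
    coadm (unsplit L R) = cosplit L R := by
  rw [coadm, h.leftCol_rightCol_unsplit.1, h.leftCol_rightCol_unsplit.2, cosplit]

/-- The letter of `L` that leaves together with the letter `b` of `R`. -/
structure Leaves {n : ℕ} (L R : Column n) (b t : Letter n) : Prop where
  le : t.val ≤ b.val
  eq : cnt L t.val = cnt R t.val
  lt : ∀ x, t.val < x → x ≤ b.val → cnt L x < cnt R x

/-- `t` is the last zero of `f = cnt L - cnt R` up to `b`; position `0` is always a zero. Removing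
`b` from `R` and `t` from `L` raises `f` by one exactly on `(t, b]`, where it was negative. -/
theorem exists_leaves {n : ℕ} {L R : Column n} (hle : ∀ x, cnt L x ≤ cnt R x)
    (h0 : cnt L 0 = cnt R 0) (b : Letter n) : ∃ t, Leaves L R b t := by
  classical
  have hex : ∃ t ≤ b.val, cnt L t = cnt R t := ⟨0, Nat.zero_le _, h0⟩
  obtain ⟨t, ⟨ht1, ht2⟩, hmax⟩ : ∃ t, (t ≤ b.val ∧ cnt L t = cnt R t) ∧
      ∀ x ≤ b.val, cnt L x = cnt R x → x ≤ t :=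
    ⟨Nat.findGreatest (fun t => cnt L t = cnt R t) b.val,
      ⟨Nat.findGreatest_le _, Nat.findGreatest_spec (P := fun t => cnt L t = cnt R t)
        (Nat.zero_le _) h0⟩,
      fun x hx hx' => Nat.le_findGreatest hx hx'⟩
  refine ⟨⟨t, by omega⟩, ht1, ht2, fun x hx hx' => ?_⟩
  have := hle x
  have h2 := hmax x hx'
  have hx : t < x := hx
  rcases lt_or_eq_of_le this with h3 | h3
  · exact h3
  · have := h2 h3
    omega

theorem Leaves.mem {n : ℕ} {L R : Column n} {b t : Letter n} (h : Leaves L R b t)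
    (hle : ∀ x, cnt L x ≤ cnt R x) (hb : b ∈ R) : t ∈ L ∧ (t ≠ b → t ∉ R) := by
  have h1 := cnt_succ L t
  have h2 := cnt_succ R t
  have h3 := h.eq
  have h4 := h.le
  by_cases hbt : t = b
  · subst hbt
    rw [ind_of_mem hb] at h2
    have := hle (t.val + 1)
    refine ⟨?_, by simp⟩
    by_contra h5
    rw [ind_of_notMem h5] at h1
    omega
  · have : t.val ≠ b.val := fun e => hbt (Fin.ext e)
    have h6 := h.lt (t.val + 1) (by omega) (by omega)
    constructor
    · by_contra h5
      rw [ind_of_notMem h5] at h1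
      have := ind_nonneg R t
      omega
    · intro _ h5
      rw [ind_of_mem h5] at h2
      have := ind_le_one L t
      omega

/-- The right column, after `b` has been removed from the column with the split form `L, R`. -/
def removeRight {n : ℕ} (R : Column n) (b t : Letter n) : Column n :=
  if t = b then R.erase b else insert (bar b) ((R.erase b).erase (bar t))

theorem mem_removeRight {n : ℕ} {R : Column n} {b t x : Letter n} : x ∈ removeRight R b t ↔
    (t = b ∧ x ≠ b ∧ x ∈ R) ∨ (t ≠ b ∧ (x = bar b ∨ (x ≠ bar t ∧ x ≠ b ∧ x ∈ R))) := by
  unfold removeRight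
  split_ifs with h <;> simp [h]

/-- The middle `n` is a zero of `f`, so the last zero up to `b` cannot lie on the other side of it.
-/
theorem Split.leaves_side {n : ℕ} {L R : Column n} (h : Split L R) {b t : Letter n}
    (ht : Leaves L R b t) : t.val < n ↔ b.val < n := by
  have h1 := h.mid
  have h2 := ht.lt n
  have h3 := ht.le
  omega

/-- The interval `(bar b, bar t]` is the reflection of `(t, b]`. -/
theorem Split.leaves_lt_bar {n : ℕ} {L R : Column n} (h : Split L R) {b t : Letter n}
    (ht : Leaves L R b t) {x : ℕ} (h1 : (bar b).val < x) (h2 : x ≤ (bar t).val) :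
    cnt L x < cnt R x := by
  rw [bar_val] at h1 h2
  have := t.isLt
  have := b.isLt
  have h3 := ht.lt (2 * n - x) (by omega) (by omega)
  have h4 := h.symm_cnt (k := x) (by omega)
  omega

theorem Split.cnt_removeRight {n : ℕ} {L R : Column n} (h : Split L R) {b t : Letter n}
    (hb : b ∈ R) (ht : Leaves L R b t) (x : ℕ) :
    cnt (removeRight R b t) x = cnt R x - (if x ≤ b.val then 1 else 0) -
      (if x ≤ (bar t).val then 1 else 0) + (if x ≤ (bar b).val then 1 else 0) := by
  by_cases hbt : t = b
  · rw [removeRight, if_pos hbt, cnt_erase hb, hbt]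
    ring
  · have hm := (ht.mem h.le hb)
    have h1 : bar t ∈ R := by
      have := h.supp t
      have := hm.2 hbt
      tauto
    have h2 : bar t ≠ b := fun e => by
      have h3 := h.leaves_side ht
      rw [← e, bar_val] at h3
      omega
    have h4 : bar b ∉ (R.erase b).erase (bar t) := by
      have := h.right b hb
      simp [this]
    rw [removeRight, if_neg hbt, cnt_insert h4, cnt_erase (Finset.mem_erase.2 ⟨h2, h1⟩),
      cnt_erase hb]

/-- The new difference exceeds `f` by one on `(t, b]` and on its reflection `(bar b, bar t]`. There
`f` was negative, so it stays at most `0`, and no previously free letter lies there. The only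
absolute value that becomes free is that of `t`, where `f` vanishes. -/
theorem Split.remove {n : ℕ} {L R : Column n} (h : Split L R) {b t : Letter n}
    (hb : b ∈ R) (ht : Leaves L R b t) : Split (L.erase t) (removeRight R b t) := by
  obtain ⟨htL, htR⟩ := ht.mem h.le hb
  have hside := h.leaves_side ht
  have hle := ht.le
  have hcR := h.cnt_removeRight hb ht
  have hcL := cnt_erase htL
  have hlt := fun x => h.leaves_lt_bar ht (x := x)
  have hlt' := ht.lt
  have heq := ht.eq
  have hbR := h.right b hb
  have htL' := h.left t htL
  have htn : bar t ≠ b := fun e => by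
    rw [← e, bar_val] at hside
    omega
  have htn' : bar b ≠ t := fun e => by
    rw [← e, bar_bar] at htn
    exact htn rfl
  have bv : ∀ x : Letter n, (bar x).val = 2 * n - 1 - x.val := bar_val
  have b2 := b.isLt
  have b3 := t.isLt
  refine ⟨?_, ?_, ?_, ?_, ?_, ?_⟩
  · intro x hx hx'
    exact h.left x (Finset.mem_of_mem_erase hx) (Finset.mem_of_mem_erase hx')
  · intro x hx hx'
    rw [mem_removeRight] at hx hx'
    exact no_pair_remove bar_bar bar_ne h.right hx hx'
  · intro x
    simp only [Finset.mem_erase, mem_removeRight]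
    exact supp_remove bar_bar h.left h.right h.supp hb htL htR htn x
  · intro x
    have h1 := hlt x
    have h2 := hlt' x
    have h3 := h.le x
    rw [hcR, hcL]
    have e1 := bv b
    have e2 := bv t
    split_ifs <;> omega
  · have h3 := h.mid
    rw [hcR, hcL]
    have e1 := bv b
    have e2 := bv t
    split_ifs <;> omega
  · intro x hx h1 h2
    have hx : x.val < n := hx
    have h3 := hlt x
    have h4 := hlt' x
    rw [hcR, hcL]
    rw [bv] at h3
    have e1 := bv b
    have e2 := bv t
    by_cases h5 : x ∈ L
    · have : x = t := by
        by_contra h6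
        exact h1 (Finset.mem_erase.2 ⟨h6, h5⟩)
      subst this
      split_ifs <;> omega
    · by_cases h6 : bar x ∈ L
      · have h7 : bar x = t := by
          by_contra h7
          exact h2 (Finset.mem_erase.2 ⟨h7, h6⟩)
        have h8 : t.val = 2 * n - 1 - x.val := by rw [← h7, bv]
        have h9 := h.symm_cnt (k := x.val) (by omega)
        have e : 2 * n - x.val = t.val + 1 := by omega
        rw [e] at h9
        have h10 := cnt_succ L t
        have h11 := cnt_succ R t
        rw [ind_of_mem htL] at h10
        by_cases hbt : t = b
        · subst hbt
          rw [ind_of_mem hb] at h11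
          split_ifs <;> omega
        · rw [ind_of_notMem (htR hbt)] at h11
          have : t.val ≠ b.val := fun e => hbt (Fin.ext e)
          split_ifs <;> omega
      · have h7 := h.zero x hx h5 h6
        split_ifs <;> omega

/-- The same change of split pairs realizes both slide rules, because `t` and `b` lie on the same
side of the middle: an unbarred `b` is removed from the column, a barred one from its coadmissible
column (`Split.cosplit_remove`). -/
theorem Split.unsplit_remove {n : ℕ} {L R : Column n} (h : Split L R) {b t : Letter n}
    (ht : Leaves L R b t) (hbu : Unbarred b) :
    unsplit (L.erase t) (removeRight R b t) = (unsplit L R).erase b := by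
  have h1 : Unbarred t := (h.leaves_side ht).2 hbu
  ext x
  have h2 : x = bar b → ¬ Unbarred x := by rintro rfl; rw [unbarred_bar]; simpa using hbu
  have h3 : x = bar t → ¬ Unbarred x := by rintro rfl; rw [unbarred_bar]; simpa using h1
  have h4 : x = b → Unbarred x := by rintro rfl; exact hbu
  have h5 : x = t → Unbarred x := by rintro rfl; exact h1
  simp only [Finset.mem_erase, mem_unsplit, mem_removeRight]
  by_cases hx : Unbarred x <;> by_cases hbt : t = b <;> simp only [hx, not_true_eq_false,
    not_false_eq_true, imp_false] at h2 h3 h4 h5 <;> simp [*]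

theorem Split.cosplit_remove {n : ℕ} {L R : Column n} (h : Split L R) {b t : Letter n}
    (ht : Leaves L R b t) (hbu : ¬ Unbarred b) :
    cosplit (L.erase t) (removeRight R b t) = (cosplit L R).erase b := by
  have h1 : ¬ Unbarred t := fun h' => hbu ((h.leaves_side ht).1 h')
  ext x
  have h2 : x = bar b → Unbarred x := by rintro rfl; rw [unbarred_bar]; exact hbu
  have h3 : x = bar t → Unbarred x := by rintro rfl; rw [unbarred_bar]; exact h1
  have h4 : x = b → ¬ Unbarred x := by rintro rfl; exact hbu
  have h5 : x = t → ¬ Unbarred x := by rintro rfl; exact h1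
  simp only [Finset.mem_erase, mem_cosplit, mem_removeRight]
  by_cases hx : Unbarred x <;> by_cases hbt : t = b <;> simp only [hx, not_true_eq_false,
    not_false_eq_true, imp_false] at h2 h3 h4 h5 <;> simp [*]

/-- The letter of the right column that enters together with the letter `b` of the left column. -/
structure Enters {n : ℕ} (B : Column n) (b e : Letter n) : Prop where
  le : b.val ≤ e.val
  side : e.val < n ↔ b.val < n
  free : e ∉ B ∧ bar e ∉ B
  supp : ∀ x : Letter n, b.val ≤ x.val → x.val < e.val → x ∈ B ∨ bar x ∈ B

/-- `e` is the least free letter from `b` on; the given free letter `m` ensures that it is on the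
same side of the middle as `b`. -/
theorem exists_enters {n : ℕ} {B : Column n} {b m : Letter n} (hbm : b.val ≤ m.val)
    (hside : m.val < n ↔ b.val < n) (hm : m ∉ B ∧ bar m ∉ B) : ∃ e, Enters B b e := by
  let S := Finset.univ.filter fun x : Letter n => b ≤ x ∧ x ∉ B ∧ bar x ∉ B
  have hmS : m ∈ S := by simp only [S, Finset.mem_filter, Finset.mem_univ, true_and]; exact ⟨hbm, hm⟩
  have hmin := Finset.min'_mem S ⟨m, hmS⟩
  have hle := Finset.min'_le S m hmS
  rw [Fin.le_def] at hle
  have hmin' : ∀ x ∈ S, S.min' ⟨m, hmS⟩ ≤ x := fun x hx => Finset.min'_le S x hx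
  generalize S.min' ⟨m, hmS⟩ = e at hmin hle hmin'
  simp only [S, Finset.mem_filter, Finset.mem_univ, true_and] at hmin hmin'
  have h1 : b.val ≤ e.val := hmin.1
  refine ⟨e, h1, by omega, hmin.2, fun x hx hx' => ?_⟩
  by_contra hcon
  have : e.val ≤ x.val := hmin' x ⟨hx, by tauto⟩
  omega

/-- The left column, after `b` has been added to the column with the split form `B, E`. -/
def addLeft {n : ℕ} (B : Column n) (b e : Letter n) : Column n :=
  if e = b then insert b B else insert (bar e) (insert b (B.erase (bar b)))

theorem mem_addLeft {n : ℕ} {B : Column n} {b e x : Letter n} : x ∈ addLeft B b e ↔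
    (e = b ∧ (x = b ∨ x ∈ B)) ∨ (e ≠ b ∧ (x = bar e ∨ x = b ∨ (x ≠ bar b ∧ x ∈ B))) := by
  unfold addLeft
  split_ifs with h <;> simp [h]

theorem Enters.bar_mem {n : ℕ} {B : Column n} {b e : Letter n} (he : Enters B b e) (hb : b ∉ B)
    (heb : e ≠ b) : bar b ∈ B := by
  have h1 := he.le
  have h2 := he.supp b le_rfl (lt_of_le_of_ne h1 fun e' => heb (Fin.ext e').symm)
  tauto

theorem Enters.cnt_addLeft {n : ℕ} {B : Column n} {b e : Letter n} (hb : b ∉ B)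
    (he : Enters B b e) (x : ℕ) :
    cnt (addLeft B b e) x = cnt B x + (if x ≤ b.val then 1 else 0) -
      (if x ≤ (bar b).val then 1 else 0) + (if x ≤ (bar e).val then 1 else 0) := by
  by_cases heb : e = b
  · rw [addLeft, if_pos heb, cnt_insert hb, heb]
    ring
  · have h1 := he.bar_mem hb heb
    have h2 : b ∉ B.erase (bar b) := by simp [hb]
    have h3 : bar e ≠ b := fun e' => by
      have h3 := he.side
      have := e.isLt
      rw [← e', bar_val] at h3
      omega
    have h4 : bar e ∉ insert b (B.erase (bar b)) := by
      simp [h3, he.free.2]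
    rw [addLeft, if_neg heb, cnt_insert h4, cnt_insert h2, cnt_erase h1]
    ring

/-- The difference `cnt B - cnt E` drops by one on `(b, e]` and on its reflection `(bar e, bar b]`.
No letter that is free afterwards lies there, since `e` was the first free letter from `b` on and is
now occupied. -/
theorem Split.add {n : ℕ} {B E : Column n} (h : Split B E) {b e : Letter n}
    (hb : b ∉ B) (he : Enters B b e) : Split (addLeft B b e) (insert e E) := by
  have hE : ¬ (e ∈ E ∨ bar e ∈ E) := by
    rw [← h.supp]
    have := he.free
    tauto
  have hside := he.side
  have hle := he.le
  have hcB := he.cnt_addLeft hb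
  have hcE := cnt_insert (a := e) (A := E) (by tauto)
  have hbm := he.bar_mem hb
  have bv : ∀ x : Letter n, (bar x).val = 2 * n - 1 - x.val := bar_val
  have b2 := b.isLt
  have b3 := e.isLt
  refine ⟨?_, ?_, ?_, ?_, ?_, ?_⟩
  · intro x hx hx'
    rw [mem_addLeft] at hx hx'
    exact no_pair_add bar_bar bar_ne h.left he.free hx hx'
  · intro x hx hx'
    rw [Finset.mem_insert] at hx hx'
    rcases hx with rfl | hx
    · exact hx'.elim (bar_ne x) fun hx' => hE (Or.inr hx')
    · rcases hx' with rfl | hx'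
      · exact hE (Or.inr (by rwa [bar_bar]))
      · exact h.right x hx hx'
  · intro x
    simp only [Finset.mem_insert, mem_addLeft]
    exact supp_add bar_bar h.supp hbm x
  · intro x
    have h3 := h.le x
    rw [hcB, hcE]
    have e1 := bv b
    have e2 := bv e
    split_ifs <;> omega
  · have h3 := h.mid
    rw [hcB, hcE]
    have e1 := bv b
    have e2 := bv e
    split_ifs <;> omega
  · intro x hx h1 h2
    have hx : x.val < n := hx
    rw [mem_addLeft] at h1 h2
    obtain ⟨h3, h4⟩ := free_of_add bar_bar h1 h2
    have h5 : x.val ≠ e.val := fun e' => h4.1 (Fin.ext e')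
    have h6 : (bar x).val ≠ e.val := fun e' => h4.2 (Fin.ext e')
    have e1 := bv b
    have e2 := bv e
    have e3 := bv x
    have h7 : ¬ (b.val < x.val ∧ x.val ≤ e.val) := fun h7 => by
      exact (he.supp x (by omega) (by omega)).elim h3.1 h3.2
    have h8 : ¬ ((bar e).val < x.val ∧ x.val ≤ (bar b).val) := fun h8 => by
      have := he.supp (bar x) (by omega) (by omega)
      rw [bar_bar] at this
      exact this.elim h3.2 h3.1
    have h9 := h.zero x hx h3.1 h3.2
    rw [hcB, hcE]
    clear hcB hcE h1 h2 h3 h4 hbm hE bv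
    split_ifs <;> omega

/-- As for removal, one change of split pairs covers both rules: an unbarred `b` joins the
coadmissible column, a barred one the column itself (`Split.unsplit_add`). -/
theorem Split.cosplit_add {n : ℕ} {B E : Column n} {b e : Letter n}
    (he : Enters B b e) (hbu : Unbarred b) :
    cosplit (addLeft B b e) (insert e E) = insert b (cosplit B E) := by
  have h1 : Unbarred e := he.side.2 hbu
  ext x
  have h2 : x = bar b → ¬ Unbarred x := by rintro rfl; rw [unbarred_bar]; simpa using hbu
  have h3 : x = bar e → ¬ Unbarred x := by rintro rfl; rw [unbarred_bar]; simpa using h1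
  have h4 : x = b → Unbarred x := by rintro rfl; exact hbu
  have h5 : x = e → Unbarred x := by rintro rfl; exact h1
  simp only [Finset.mem_insert, mem_cosplit, mem_addLeft]
  by_cases hx : Unbarred x <;> by_cases hbt : e = b <;> simp only [hx, not_true_eq_false,
    not_false_eq_true, imp_false] at h2 h3 h4 h5 <;> simp [*]

theorem Split.unsplit_add {n : ℕ} {B E : Column n} {b e : Letter n}
    (he : Enters B b e) (hbu : ¬ Unbarred b) :
    unsplit (addLeft B b e) (insert e E) = insert b (unsplit B E) := by
  have h1 : ¬ Unbarred e := fun h' => hbu (he.side.1 h')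
  ext x
  have h2 : x = bar b → Unbarred x := by rintro rfl; rw [unbarred_bar]; exact hbu
  have h3 : x = bar e → Unbarred x := by rintro rfl; rw [unbarred_bar]; exact h1
  have h4 : x = b → ¬ Unbarred x := by rintro rfl; exact hbu
  have h5 : x = e → ¬ Unbarred x := by rintro rfl; exact h1
  simp only [Finset.mem_insert, mem_unsplit, mem_addLeft]
  by_cases hx : Unbarred x <;> by_cases hbt : e = b <;> simp only [hx, not_true_eq_false,
    not_false_eq_true, imp_false] at h2 h3 h4 h5 <;> simp [*]

/-! ### One slide of two columns in split form -/

/-- `A` consists of the letters of `L` that are matched with those letters of `R` that are matched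
with `B`. -/
def KeyRel {n : ℕ} (L R B A : Column n) : Prop :=
  ∀ x, (∀ y w, x ≤ y → y ≤ w →
      (cnt L y - cnt R y) + (cnt R w - cnt B w) ≤ cnt L x - cnt A x) ∧
    ∃ y w, x ≤ y ∧ y ≤ w ∧ (cnt L y - cnt R y) + (cnt R w - cnt B w) = cnt L x - cnt A x

/-- The situation in the course of the jeu de taquin, when `j` slides have been made and `s` slides
are left, and all letters that have been moved are below `lo`. -/
structure SlideState {n : ℕ} (L R B E : Column n) (j s lo : ℕ) : Prop where
  left : Split L R
  right : Split B E
  le : ∀ x, cnt R x - cnt B x ≤ s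
  top : cnt R lo - cnt B lo = s
  card : s + cnt B 0 = cnt R 0 + j
  low : ∀ c ≤ n, lo ≤ 2 * n - c → cnt B 0 - cnt B c + cnt R (2 * n - c) ≤ c
  high : ∀ c ≤ n, lo ≤ c → cnt R 0 - cnt R c + cnt R (2 * n - c) + j ≤ c

/-- The letter that moves to the right in a slide. -/
structure Moves {n : ℕ} (R B : Column n) (s : ℕ) (b : Letter n) : Prop where
  mem : b ∈ R
  notMem : b ∉ B
  eq : cnt R b.val - cnt B b.val = s + 1
  lt : ∀ x, b.val < x → cnt R x - cnt B x ≤ s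

theorem Moves.succ {n : ℕ} {R B : Column n} {s : ℕ} {b : Letter n} (h : Moves R B s b) :
    cnt R (b.val + 1) - cnt B (b.val + 1) = s := by
  have h1 := cnt_succ R b
  have h2 := cnt_succ B b
  have h3 := h.eq
  rw [ind_of_mem h.mem] at h1
  rw [ind_of_notMem h.notMem] at h2
  omega

/-- `b` is the last position where `g = cnt R - cnt B` attains its maximum `s + 1`. Since `g` drops
right behind it, `b` is in `R` and not in `B`. -/
theorem SlideState.exists_moves {n : ℕ} {L R B E : Column n} {j s lo : ℕ}
    (h : SlideState L R B E j (s + 1) lo) : ∃ b, Moves R B s b ∧ lo ≤ b.val := by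
  have hlo : lo < 2 * n := by
    by_contra hcon
    have h1 := h.top
    rw [cnt_of_le R (by omega), cnt_of_le B (by omega)] at h1
    push_cast at h1
    omega
  have htop := h.top
  push_cast at htop
  obtain ⟨b, hb1, hb2, hmax⟩ : ∃ b, b ≤ 2 * n ∧ cnt R b - cnt B b = s + 1 ∧
      ∀ x ≤ 2 * n, cnt R x - cnt B x = s + 1 → x ≤ b :=
    ⟨Nat.findGreatest (fun t => cnt R t - cnt B t = s + 1) (2 * n), Nat.findGreatest_le _,
      Nat.findGreatest_spec (P := fun t => cnt R t - cnt B t = s + 1) hlo.le htop,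
      fun x hx hx' => Nat.le_findGreatest hx hx'⟩
  have hb3 : b < 2 * n := by
    by_contra hcon
    rw [cnt_of_le R (by omega), cnt_of_le B (by omega)] at hb2
    omega
  have hlt : ∀ x, b < x → cnt R x - cnt B x ≤ s := by
    intro x hx
    by_cases hx' : x ≤ 2 * n
    · have h1 := h.le x
      push_cast at h1
      have h2 := hmax x hx'
      omega
    · rw [cnt_of_le R (by omega), cnt_of_le B (by omega)]
      omega
  let b' : Letter n := ⟨b, hb3⟩
  have e1 : cnt R b = cnt R (b + 1) + ind R b' := cnt_succ R b'
  have e2 : cnt B b = cnt B (b + 1) + ind B b' := cnt_succ B b'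
  have e3 := hlt (b + 1) (by omega)
  have e4 := ind_le_one R b'
  have e5 := ind_nonneg B b'
  refine ⟨b', ⟨?_, ?_, hb2, hlt⟩, hmax lo hlo.le htop⟩
  · by_contra hcon
    rw [ind_of_notMem hcon] at e1
    omega
  · intro hcon
    rw [ind_of_mem hcon] at e2
    omega

/-- Otherwise `B` or its bars fill all letters from `b` to the end of its side. For unbarred `b`,
folding gives `g b ≤ g (2n - b)`, although `g` stays below its maximum behind `b`. For barred `b`,
the invariant `low` at `2n - b` gives `g b ≤ 0`. -/
theorem SlideState.exists_enters {n : ℕ} {L R B E : Column n} {j s lo : ℕ}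
    (h : SlideState L R B E j (s + 1) lo) {b : Letter n} (hb : Moves R B s b)
    (hlo : lo ≤ b.val) : ∃ e, Enters B b e := by
  have e : 2 * n - n = n := by omega
  have hb2 := b.isLt
  by_contra hcon
  have hsupp : ∀ m : Letter n, b.val ≤ m.val → (m.val < n ↔ b.val < n) → m ∈ B ∨ bar m ∈ B := by
    intro m h1 h2
    by_contra h3
    exact hcon (KN.exists_enters h1 h2 (by tauto))
  have heq := hb.eq
  by_cases hbn : b.val < n
  · have h1 := cnt_fold_full B h.right.left hbn.le le_rfl
      (fun x hx hx' => hsupp x hx (by omega))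
    have h2 := (cnt_fold_le R h.left.right hbn.le le_rfl).2
    rw [e] at h1 h2
    have h3 := hb.lt (2 * n - b.val) (by omega)
    omega
  · have h1 := cnt_fold_full B h.right.left (Nat.zero_le (2 * n - b.val)) (by omega)
      (fun x hx hx' => by
        have := hsupp (bar x) (by rw [bar_val]; omega) (by rw [bar_val]; omega)
        rw [bar_bar] at this
        tauto)
    have e' : 2 * n - (2 * n - b.val) = b.val := by omega
    have h2 := h.low (2 * n - b.val) (by omega) (by omega)
    have h3 := cnt_of_le B (x := 2 * n - 0) (by omega)
    rw [e'] at h1 h2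
    push_cast at h1 h2
    omega

/-! ### The change of `f`, `g` and the invariants in one slide -/

section Step

variable {n : ℕ} {L R B E : Column n} {j s lo : ℕ} {b t e : Letter n}

/-- On this interval the slide raises `g` by one. As `B` is full from `b` up to `2n - x`, folding
gives `g b - g (2n - b) ≤ g (2n - x) - g x`, and `2n - x` lies behind `b`; so the raised value is
still bounded by an old value of `g`. -/
theorem Moves.lt_of_enters (hR : ∀ x ∈ R, bar x ∉ R) (hB : ∀ x ∈ B, bar x ∉ B)
    (hb : Moves R B s b) (he : Enters B b e) {x : ℕ} (h1 : b.val < x) (h2 : (bar e).val < x)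
    (h3 : x ≤ (bar b).val) :
    cnt R x - cnt B x + 1 ≤ cnt R (2 * n - b.val) - cnt B (2 * n - b.val) := by
  rw [bar_val] at h2 h3
  have e1 := e.isLt
  have hside := he.side
  have h4 := cnt_fold_full B hB (k := b.val) (m := 2 * n - x) (by omega) (by omega)
    (fun y hy hy' => he.supp y hy (by omega))
  have h5 := (cnt_fold_le R hR (k := b.val) (m := 2 * n - x) (by omega) (by omega)).2
  have e2 : 2 * n - (2 * n - x) = x := by omega
  rw [e2] at h4 h5
  have h6 := hb.eq
  have h7 := hb.lt (2 * n - x) (by omega)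
  omega

/-- On this interval the slide lowers `g`. Since `f < 0` on `(t, b]`, no letter there is free, so
`R` is full on the reflected range, and folding compares `g x` with `g (2n - b)`. -/
theorem Moves.le_of_leaves (h : Split L R) (hB : ∀ x ∈ B, bar x ∉ B)
    (hle : ∀ x, cnt R x - cnt B x ≤ s + 1) (hb : Moves R B s b) (ht : Leaves L R b t) {x : ℕ}
    (h1 : b.val < x) (h2 : (bar b).val < x) (h3 : x ≤ (bar t).val) :
    cnt R x - cnt B x ≤ cnt R (2 * n - b.val) - cnt B (2 * n - b.val) := by
  rw [bar_val] at h2 h3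
  have e1 := b.isLt
  have hside := h.leaves_side ht
  have h4 := cnt_fold_full R h.right (k := 2 * n - x) (m := b.val) (by omega) (by omega)
    (fun y hy hy' => by
      rw [← h.supp]
      by_contra hcon
      have h5 := h.zero_all (x := y) (by tauto) (by tauto)
      have h6 := ht.lt y.val (by omega) (by omega)
      omega)
  have h5 := (cnt_fold_le B hB (k := 2 * n - x) (m := b.val) (by omega) (by omega)).2
  have e2 : 2 * n - (2 * n - x) = x := by omega
  rw [e2] at h4 h5
  have h6 := hb.eq
  have h7 := hle (2 * n - x)
  omega

theorem SlideState.cnt_sub (h : SlideState L R B E j (s + 1) lo) (hb : Moves R B s b)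
    (ht : Leaves L R b t) (he : Enters B b e) (x : ℕ) :
    cnt (removeRight R b t) x - cnt (addLeft B b e) x = cnt R x - cnt B x -
      (if x ≤ b.val then 2 else 0) - (if (bar b).val < x ∧ x ≤ (bar t).val then 1 else 0) +
      (if (bar e).val < x ∧ x ≤ (bar b).val then 1 else 0) := by
  rw [h.left.cnt_removeRight hb.mem ht, he.cnt_addLeft hb.notMem]
  have h1 := bar_val b
  have h2 := bar_val t
  have h3 := bar_val e
  have h4 := ht.le
  have h5 := he.le
  have h6 := e.isLt
  split_ifs <;> omega

theorem SlideState.cnt_sub' (h : SlideState L R B E j (s + 1) lo) (hb : Moves R B s b)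
    (ht : Leaves L R b t) (x : ℕ) :
    cnt (L.erase t) x - cnt (removeRight R b t) x = cnt L x - cnt R x +
      (if t.val < x ∧ x ≤ b.val then 1 else 0) +
      (if (bar b).val < x ∧ x ≤ (bar t).val then 1 else 0) := by
  rw [h.left.cnt_removeRight hb.mem ht, cnt_erase (ht.mem h.left.le hb.mem).1]
  have h1 := bar_val b
  have h2 := bar_val t
  have h4 := ht.le
  have h6 := b.isLt
  split_ifs <;> omega

theorem SlideState.step_le (h : SlideState L R B E j (s + 1) lo) (hb : Moves R B s b)
    (ht : Leaves L R b t) (he : Enters B b e) (x : ℕ) :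
    cnt (removeRight R b t) x - cnt (addLeft B b e) x ≤ s := by
  rw [h.cnt_sub hb ht he]
  have h1 := h.le x
  have h2 := hb.lt x
  push_cast at h1
  have h3 := bar_val b
  have h4 := b.isLt
  have h5 : b.val < x → (bar e).val < x → x ≤ (bar b).val → cnt R x - cnt B x + 1 ≤ s := by
    intro h5 h6 h7
    have h8 := hb.lt_of_enters h.left.right h.right.left he h5 h6 h7
    have h9 := hb.lt (2 * n - b.val) (by omega)
    omega
  split_ifs <;> omega

/-- Position `b + 1` avoids both reflected intervals, because `t` and `e` lie on the same side of
the middle as `b`. So `g` keeps there its value `s`. -/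
theorem SlideState.step_top (h : SlideState L R B E j (s + 1) lo) (hb : Moves R B s b)
    (ht : Leaves L R b t) (he : Enters B b e) :
    cnt (removeRight R b t) (b.val + 1) - cnt (addLeft B b e) (b.val + 1) = s := by
  rw [h.cnt_sub hb ht he, hb.succ]
  have h1 := bar_val b
  have h2 := bar_val t
  have h3 := bar_val e
  have h4 := h.left.leaves_side ht
  have h5 := he.side
  have h6 := b.isLt
  have h7 := e.isLt
  split_ifs <;> omega

theorem SlideState.step (h : SlideState L R B E j (s + 1) lo) (hb : Moves R B s b)
    (hlo : lo ≤ b.val) (ht : Leaves L R b t) (he : Enters B b e) :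
    SlideState (L.erase t) (removeRight R b t) (addLeft B b e) (insert e E) (j + 1) s
      (b.val + 1) := by
  have hcR := h.left.cnt_removeRight hb.mem ht
  have hcB := he.cnt_addLeft hb.notMem
  have h1 := bar_val b
  have h2 := bar_val t
  have h3 := bar_val e
  have h4 := h.left.leaves_side ht
  have h5 := he.side
  have h6 := b.isLt
  have h7 := e.isLt
  have h8 := ht.le
  have h9 := he.le
  have hcard := h.card
  push_cast at hcard
  refine ⟨h.left.remove hb.mem ht, h.right.add hb.notMem he, h.step_le hb ht he,
    h.step_top hb ht he, ?_, ?_, ?_⟩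
  · rw [hcR, hcB]
    simp only [Nat.zero_le, if_true]
    push_cast
    omega
  · intro c hc hc'
    have h10 := h.low c hc (by omega)
    have q1 := hcB 0
    have q2 := hcB c
    have q3 := hcR (2 * n - c)
    rw [if_pos (by omega), if_pos (by omega), if_pos (by omega)] at q1
    rw [if_neg (by omega)] at q3
    clear hcR hcB
    by_cases hbn : b.val < n
    -- The letter `b` enters `B` before `c`; room for it comes from `high` at `c`, combined with `g
    -- c ≤ s` and the relation between the lengths.
    · have h11 : b.val < c → cnt B 0 - cnt B c + cnt R (2 * n - c) + 1 ≤ c := by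
        intro h11
        have h12 := h.high c hc (by omega)
        have h13 := hb.lt c h11
        omega
      clear hb he ht h
      omega
    -- Now it is `bar e` that enters before `c`. Room comes from `low` at `2n - b`, transported to
    -- `c` across a range filled by `B`, and from `g (2n - c) ≤ s < g b`.
    · have h11 : (bar e).val < c → cnt B 0 - cnt B c + cnt R (2 * n - c) + 1 ≤ c := by
        intro h11
        have h12 := h.low (2 * n - b.val) (by omega) (by omega)
        have h13 := cnt_fold_full B h.right.left (k := c) (m := 2 * n - b.val) (by omega) (by omega)
          (fun x hx hx' => by
            have := he.supp (bar x) (by rw [bar_val]; omega) (by rw [bar_val]; omega)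
            rw [bar_bar] at this
            tauto)
        have e' : 2 * n - (2 * n - b.val) = b.val := by omega
        rw [e'] at h12 h13
        have h14 := hb.lt (2 * n - c) (by omega)
        have h15 := hb.eq
        omega
      clear hb he ht h
      omega
  · intro c hc hc'
    have h10 := h.high c hc (by omega)
    have q1 := hcR 0
    have q2 := hcR c
    have q3 := hcR (2 * n - c)
    rw [if_pos (by omega), if_pos (by omega), if_pos (by omega)] at q1
    rw [if_neg (by omega), if_pos (by omega), if_pos (by omega)] at q2
    rw [if_neg (by omega), if_pos (by omega), if_pos (by omega)] at q3
    push_cast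
    omega

/-- For `x ≤ t` the maximum and the count of `L` both lose one in the slide. For `x > t` the count
of `L` is unchanged, and so is the maximum: wherever `f` or `g` changes, a suitable shift of `y` or
`w` compensates. -/
theorem SlideState.keyRel_of_step (h : SlideState L R B E j (s + 1) lo) (hb : Moves R B s b)
    (ht : Leaves L R b t) (he : Enters B b e) {A : Column n}
    (hA : KeyRel (L.erase t) (removeRight R b t) (addLeft B b e) A) : KeyRel L R B A := by
  have hS := h.left.remove hb.mem ht
  have F := h.cnt_sub' hb ht
  have G := h.cnt_sub hb ht he
  have hg' := h.step_le hb ht he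
  have htop := h.step_top hb ht he
  have hf' := hS.le
  have hcL := cnt_erase (ht.mem h.left.le hb.mem).1
  have h1 := bar_val b
  have h2 := bar_val t
  have h3 := bar_val e
  have h4 := h.left.leaves_side ht
  have h5 := he.side
  have h6 := b.isLt
  have h7 := e.isLt
  have h8 := ht.le
  have h9 := he.le
  have hle := h.le
  push_cast at hle
  have hf := h.left.le
  have hbe := hb.eq
  have hte := ht.eq
  intro x
  obtain ⟨hA1, y₀, w₀, hA2, hA3, hA4⟩ := hA x
  rw [hcL x] at hA4
  simp only [hcL x] at hA1
  by_cases hxt : x ≤ t.val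
  · rw [if_pos hxt] at hA4 hA1
    have k1 := hA1 t.val (b.val + 1) hxt (by omega)
    have k2 := hf' y₀
    have k3 := hg' w₀
    have k4 := F t.val
    rw [if_neg (by omega), if_neg (by omega)] at k4
    -- Both maxima are explicit: `f t + g b = s + 1` before the slide, and `s` after it, attained at
    -- `t` and `b + 1`.
    refine ⟨fun y w hy hw => ?_, t.val, b.val, hxt, h8, by omega⟩
    have k5 := hf y
    have k6 := hle w
    omega
  · rw [if_neg hxt] at hA4 hA1
    have upper : ∀ y w, x ≤ y → y ≤ w →
        (cnt L y - cnt R y) + (cnt R w - cnt B w) ≤ cnt L x - cnt A x := by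
      intro y w hy hw
      -- For `w ≤ b` the gain of `f` at `y` pays for replacing `g w ≤ s + 1` by the new value `s` at
      -- `b + 1`.
      by_cases c1 : w ≤ b.val
      · have k1 := hA1 y (b.val + 1) hy (by omega)
        have k2 := F y
        rw [if_pos (by omega)] at k2
        have k3 := hle w
        split_ifs at k2 <;> omega
      · have k1 := hA1 y w hy hw
        have k2 := F y
        have k3 := G w
        rw [if_neg c1] at k3
        by_cases c2 : (bar b).val < w ∧ w ≤ (bar t).val
        · by_cases c3 : b.val < y ∧ y ≤ (bar b).val
          -- Only here is the loss of `g` at `w` not offset by a gain of `f` at `y`. Then `w` is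
          -- moved to `bar b`, where the new `g` equals the old `g (2n - b)`, which is at least `g
          -- w`.
          · have k4 := hA1 y (bar b).val hy c3.2
            have k5 := G (bar b).val
            have k6 := hb.le_of_leaves h.left h.right.left hle ht (by omega) c2.1 c2.2
            have k7 := cnt_succ R (bar b)
            have k8 := cnt_succ B (bar b)
            have e1 : (bar b).val + 1 = 2 * n - b.val := by omega
            rw [ind_of_notMem (h.left.right b hb.mem), e1] at k7
            rw [e1] at k8
            have k9 : ind B (bar b) = if (bar e).val < (bar b).val then 1 else 0 := by
              split_ifs with c4
              · exact ind_of_mem (he.bar_mem hb.notMem fun e' => by rw [e'] at c4; omega)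
              · have : e = b := Fin.ext (by omega)
                rw [← this]
                exact ind_of_notMem he.free.2
            split_ifs at k2 k3 k5 k9 <;> omega
          · split_ifs at k2 k3 <;> omega
        · split_ifs at k2 k3 <;> omega
    refine ⟨upper, ?_⟩
    suffices hlow : ∃ y w, x ≤ y ∧ y ≤ w ∧
        cnt L x - cnt A x ≤ (cnt L y - cnt R y) + (cnt R w - cnt B w) by
      obtain ⟨y, w, hy, hw, hyw⟩ := hlow
      exact ⟨y, w, hy, hw, le_antisymm (upper y w hy hw) hyw⟩
    have k1 := F y₀
    have k2 := G w₀
    have k3 := hg' w₀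
    by_cases c1 : y₀ ≤ b.val
    -- The gain of `f` is balanced by the old maximum `s + 1` of `g` at `b`, the new maximum being
    -- `s`.
    · refine ⟨y₀, b.val, hA2, c1, ?_⟩
      split_ifs at k1 <;> omega
    · by_cases c2 : (bar b).val < y₀ ∧ y₀ ≤ (bar t).val
      · by_cases c3 : w₀ ≤ (bar t).val
        · refine ⟨y₀, w₀, hA2, hA3, ?_⟩
          split_ifs at k1 k2 <;> omega
        -- The position `bar t + 1 = 2n - t` reflects `t`, so `f` vanishes there and is at least the
        -- new value at `y₀`.
        · refine ⟨(bar t).val + 1, w₀, by omega, by omega, ?_⟩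
          have k4 := h.left.leaves_lt_bar ht c2.1 c2.2
          have k5 := h.left.symm_cnt (k := t.val) (by omega)
          have e1 : (bar t).val + 1 = 2 * n - t.val := by omega
          rw [e1]
          split_ifs at k1 k2 <;> omega
      · by_cases c3 : (bar e).val < w₀ ∧ w₀ ≤ (bar b).val
        -- The old value of `g` at `2n - b` is at least the raised value at `w₀`.
        · refine ⟨y₀, 2 * n - b.val, hA2, by omega, ?_⟩
          have k4 := hb.lt_of_enters h.left.right h.right.left he (by omega) c3.1 c3.2
          split_ifs at k1 k2 <;> omega
        · refine ⟨y₀, w₀, hA2, hA3, ?_⟩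
          split_ifs at k1 k2 <;> omega

end Step

/-- With no slide left, `f` and `g` are at most `0`, so the maximum is `0`. The witness `x + 2n`
lies behind all letters, where every count vanishes. -/
theorem SlideState.keyRel_self {n : ℕ} {L R B E : Column n} {j lo : ℕ}
    (h : SlideState L R B E j 0 lo) : KeyRel L R B L := by
  intro x
  refine ⟨fun y w _ _ => ?_, x + 2 * n, x + 2 * n, by omega, le_rfl, ?_⟩
  · have h1 := h.left.le y
    have h2 := h.le w
    push_cast at h2
    omega
  · rw [cnt_of_le _ (by omega), cnt_of_le _ (by omega), cnt_of_le _ (by omega)]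
    omega

theorem KeyRel.unique {n : ℕ} {L R B A A' : Column n} (h : KeyRel L R B A)
    (h' : KeyRel L R B A') : A = A' := by
  apply cnt_ext
  intro x
  obtain ⟨h1, y, w, h2, h3, h4⟩ := h x
  obtain ⟨h1', y', w', h2', h3', h4'⟩ := h' x
  have := h1 y' w' h2' h3'
  have := h1' y w h2 h3
  omega

/-! ### Rows -/

theorem getElem?_eq_some_iff_of_sorted {α : Type*} [LinearOrder α] {l : List α}
    (h : l.Pairwise (· < ·)) {q : ℕ} {b : α} :
    l[q]? = some b ↔ b ∈ l ∧ (l.filter (· < b)).length = q := by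
  induction l generalizing q with
  | nil => simp
  | cons a l ih =>
    rw [List.pairwise_cons] at h
    by_cases hab : b = a
    · subst hab
      have h1 : b ∉ l := fun h1 => lt_irrefl _ (h.1 b h1)
      have h2 : (b :: l).filter (· < b) = [] := by
        rw [List.filter_eq_nil_iff]
        intro x hx
        rcases List.mem_cons.1 hx with rfl | hx
        · simp
        · simpa using (h.1 x hx).le
      rw [h2]
      cases q with
      | zero => simp
      | succ q => simp [List.getElem?_cons_succ, ih h.2, h1]
    · have h3 : b ∈ l → ((a :: l).filter (· < b)).length = (l.filter (· < b)).length + 1 := by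
        intro hb
        rw [List.filter_cons_of_pos (by simpa using h.1 b hb), List.length_cons]
      cases q with
      | zero =>
        simp only [List.getElem?_cons_zero, Option.some.injEq, List.mem_cons, hab, false_or]
        constructor
        · intro e; exact absurd e.symm hab
        · rintro ⟨hb, e⟩
          rw [h3 hb] at e
          omega
      | succ q =>
        simp only [List.getElem?_cons_succ, ih h.2, List.mem_cons, hab, false_or]
        constructor
        · rintro ⟨hb, e⟩
          exact ⟨hb, by rw [h3 hb, e]⟩
        · rintro ⟨hb, e⟩
          rw [h3 hb] at e
          exact ⟨hb, by omega⟩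

theorem length_filter_rows {n : ℕ} (C : Column n) (b : Letter n) :
    (((rows C).filter (· < b)).length : ℤ) = cnt C 0 - cnt C b.val := by
  have h1 : ((rows C).filter (· < b)).toFinset = C \ C.filter fun a => b.val ≤ a.val := by
    ext x
    simp only [List.mem_toFinset, List.mem_filter, mem_rows, decide_eq_true_eq, Finset.mem_sdiff,
      Finset.mem_filter, Fin.lt_def]
    by_cases hx : x ∈ C <;> simp [hx]
  have h2 : ((rows C).filter (· < b)).Nodup :=
    ((rows_pairwise C).imp fun h => h.ne).filter _
  rw [← List.toFinset_card_of_nodup h2, h1]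
  have h3 := Finset.card_sdiff_add_card_eq_card
    (Finset.filter_subset (fun a : Letter n => b.val ≤ a.val) C)
  have h4 := cnt_zero C
  have h5 : cnt C b.val = ((C.filter fun a => b.val ≤ a.val).card : ℤ) := rfl
  omega

theorem rows_getElem? {n : ℕ} {C : Column n} {q : ℕ} {b : Letter n} :
    (rows C)[q]? = some b ↔ b ∈ C ∧ cnt C 0 - cnt C b.val = q := by
  rw [getElem?_eq_some_iff_of_sorted (rows_pairwise C), mem_rows, ← length_filter_rows]
  norm_cast

theorem length_rows {n : ℕ} (C : Column n) : (rows C).length = C.card := Finset.length_sort _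

/-! ### Slides are determined -/

theorem LeftOfPuncture.unique {n : ℕ} {j : ℕ} {C : Column n} {p : ℕ} {b b' : Letter n}
    (h : LeftOfPuncture j C p b) (h' : LeftOfPuncture j C p b') : b = b' := by
  have := h.2.symm.trans h'.2
  simpa using this

theorem ReverseSlide.unique {n : ℕ} {j : ℕ} {C D : Column n} {p : ℕ} {C₁ D₁ C₂ D₂ : Column n}
    (h₁ : ReverseSlide j C D p C₁ D₁) (h₂ : ReverseSlide j C D p C₂ D₂) :
    C₁ = C₂ ∧ D₁ = D₂ := by
  induction h₁ with
  | up above le _ ih =>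
    cases h₂ with
    | up _ _ next' => exact ih next'
    | barred left lt => exact absurd (le _ left) (not_le.2 (lt _ above))
    | unbarred left lt => exact absurd (le _ left) (not_le.2 (lt _ above))
  | barred left lt hb _ adm_left _ hC =>
    cases h₂ with
    | up above le => exact absurd (le _ left) (not_le.2 (lt _ above))
    | barred left' _ _ _ adm_left' _ hC' =>
      obtain rfl := left.unique left'
      exact ⟨coadm_injective adm_left adm_left' (hC.trans hC'.symm), rfl⟩
    | unbarred left' _ hb' =>
      obtain rfl := left.unique left'
      exact absurd hb' hb
  | unbarred left lt hb _ _ adm_right hD =>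
    cases h₂ with
    | up above le => exact absurd (le _ left) (not_le.2 (lt _ above))
    | barred left' _ hb' =>
      obtain rfl := left.unique left'
      exact absurd hb hb'
    | unbarred left' _ _ _ _ adm_right' hD' =>
      obtain rfl := left.unique left'
      exact ⟨rfl, coadm_injective adm_right adm_right' (hD.trans hD'.symm)⟩

theorem SlidePath.unique {n : ℕ} {C D : Column n} {j : ℕ} {C₁ D₁ C₂ D₂ : Column n}
    (h₁ : SlidePath C D j C₁ D₁) (h₂ : SlidePath C D j C₂ D₂) : C₁ = C₂ ∧ D₁ = D₂ := by
  induction h₁ generalizing C₂ D₂ with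
  | start => cases h₂; exact ⟨rfl, rfl⟩
  | slide _ _ step ih =>
    cases h₂ with
    | slide path' _ step' =>
      obtain ⟨rfl, rfl⟩ := ih path'
      exact step.unique step'

/-! ### Slides can be carried out -/

/-- The puncture stops in row `pb`, the number of letters of `B` before `b`. The relation between
the lengths and `g b = s + 1` place `b` exactly to its left, and in lower rows `g ≤ s` behind `b`
forces the puncture up. -/
theorem SlideState.reverseSlide {n : ℕ} {L R B E : Column n} {j s lo : ℕ} {b t e : Letter n}
    (h : SlideState L R B E j (s + 1) lo) (hb : Moves R B s b) (ht : Leaves L R b t)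
    (he : Enters B b e) :
    ReverseSlide j (unsplit L R) (unsplit B E) B.card (unsplit (L.erase t) (removeRight R b t))
      (unsplit (addLeft B b e) (insert e E)) := by
  have hL' := h.left.remove hb.mem ht
  have hB' := h.right.add hb.notMem he
  have hrC := h.left.leftCol_rightCol_unsplit.2
  have hlD := h.right.leftCol_rightCol_unsplit.1
  have hcard := h.card
  have hbe := hb.eq
  push_cast at hcard
  have hnn : 0 ≤ cnt B 0 - cnt B b.val := sub_nonneg.2 (cnt_anti B (Nat.zero_le _))
  have hnn' : 0 ≤ cnt R 0 - cnt R b.val := sub_nonneg.2 (cnt_anti R (Nat.zero_le _))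
  obtain ⟨pb, hpb⟩ := Int.eq_ofNat_of_zero_le hnn
  have hle : pb ≤ B.card := by
    have h1 := cnt_zero B
    have h2 := cnt_nonneg B b.val
    omega
  have hleft : LeftOfPuncture j (unsplit L R) pb b := by
    refine ⟨by omega, ?_⟩
    rw [hrC, rows_getElem?]
    exact ⟨hb.mem, by omega⟩
  have hlt : ∀ a, AbovePuncture (unsplit B E) pb a → a < b := by
    rintro a ⟨q, hq, ha⟩
    rw [hlD, rows_getElem?] at ha
    rw [Fin.lt_def]
    by_contra hcon
    have := cnt_anti B (x := b.val) (y := a.val) (by omega)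
    omega
  suffices key : ∀ p, pb ≤ p → p ≤ B.card → ReverseSlide j (unsplit L R) (unsplit B E) p
      (unsplit (L.erase t) (removeRight R b t)) (unsplit (addLeft B b e) (insert e E)) from
    key _ hle le_rfl
  intro p hp
  induction p, hp using Nat.le_induction with
  | base =>
    intro _
    by_cases hbu : Unbarred b
    · rw [h.left.unsplit_remove ht hbu]
      refine ReverseSlide.unbarred hleft hlt hbu ?_ ?_ hB'.admissible ?_
      · rw [h.right.coadm_unsplit, mem_cosplit]
        have := hb.notMem
        tauto
      · rw [← h.left.unsplit_remove ht hbu]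
        exact hL'.admissible
      · rw [h.right.coadm_unsplit, hB'.coadm_unsplit, Split.cosplit_add he hbu]
    · rw [Split.unsplit_add he hbu]
      refine ReverseSlide.barred hleft hlt hbu ?_ hL'.admissible ?_ ?_
      · rw [mem_unsplit]
        have := hb.notMem
        tauto
      · rw [← Split.unsplit_add he hbu]
        exact hB'.admissible
      · rw [h.left.coadm_unsplit, hL'.coadm_unsplit, h.left.cosplit_remove ht hbu]
  | succ p hp ih =>
    intro hpB
    have hlen : p < (rows B).length := by rw [length_rows]; omega
    have ha : (rows B)[p]? = some (rows B)[p] := List.getElem?_eq_getElem hlen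
    refine ReverseSlide.up ⟨p, rfl, by rw [hlD]; exact ha⟩ ?_ (ih (by omega))
    generalize (rows B)[p] = a at ha
    rw [rows_getElem?] at ha
    rintro b' ⟨hj, hb'⟩
    rw [hrC, rows_getElem?] at hb'
    rw [Fin.le_def]
    -- A left neighbour bigger than `a` would give `g (a + 1) ≥ s + 1`, although `a + 1` lies behind
    -- `b`.
    by_contra hcon
    have h1 := cnt_anti R (x := a.val + 1) (y := b'.val) (by omega)
    have h2 := cnt_succ B a
    rw [ind_of_mem ha.1] at h2
    have h3 : b.val < a.val + 1 := by
      by_contra h3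
      have := cnt_anti B (x := a.val + 1) (y := b.val) (by omega)
      omega
    have h4 := hb.lt _ h3
    omega

theorem SlideState.card_left {n : ℕ} {L R B E : Column n} {j s lo : ℕ}
    (h : SlideState L R B E j s lo) : ((unsplit L R).card : ℤ) = cnt R 0 := by
  have h1 := card_rightCol h.left.admissible
  rw [h.left.leftCol_rightCol_unsplit.2] at h1
  rw [cnt_zero, h1]

theorem SlideState.card_right {n : ℕ} {L R B E : Column n} {j s lo : ℕ}
    (h : SlideState L R B E j s lo) : ((unsplit B E).card : ℤ) = cnt B 0 := by
  have h1 := card_leftCol h.right.admissible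
  rw [h.right.leftCol_rightCol_unsplit.1] at h1
  rw [cnt_zero, h1]

/-- What is reached after `j` slides of the `m` slides that swap the column lengths. -/
def Reached {n : ℕ} (C D : Column n) (m j : ℕ) (L R B E : Column n) : Prop :=
  (∃ lo, SlideState L R B E j (m - j) lo) ∧
  SlidePath C D j (unsplit L R) (unsplit B E) ∧
  (unsplit L R).card + j = C.card ∧ (unsplit B E).card = D.card + j ∧
  ∀ A, KeyRel L R B A → KeyRel (leftCol C) (rightCol C) (leftCol D) A

theorem SlideState.start {n : ℕ} {C D : Column n} (hC : Admissible C) (hD : Admissible D)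
    (hcard : D.card ≤ C.card)
    (hle : ∀ x, cnt (rightCol C) x - cnt (leftCol D) x ≤ C.card - D.card) :
    SlideState (leftCol C) (rightCol C) (leftCol D) (rightCol D) 0 (C.card - D.card) 0 := by
  have h1 : cnt (rightCol C) 0 = C.card := by rw [cnt_zero, card_rightCol hC]
  have h2 : cnt (leftCol D) 0 = D.card := by rw [cnt_zero, card_leftCol hD]
  have hCs := split_of_admissible hC
  have key : ∀ c ≤ n, cnt (rightCol C) 0 - cnt (rightCol C) c +
      cnt (rightCol C) (2 * n - c) ≤ c := by
    intro c hc
    have h3 := (cnt_fold_le _ hCs.right (Nat.zero_le c) hc).2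
    have h4 := cnt_of_le (rightCol C) (x := 2 * n - 0) (by omega)
    push_cast at h3
    omega
  refine ⟨hCs, split_of_admissible hD, fun x => ?_, ?_, ?_, fun c hc _ => ?_, fun c hc _ => ?_⟩
  · rw [Nat.cast_sub hcard]; exact hle x
  · rw [h1, h2, Nat.cast_sub hcard]
  · rw [h1, h2, Nat.cast_sub hcard]; push_cast; ring
  · have := key c hc
    have := hle c
    omega
  · have := key c hc
    push_cast
    omega

theorem exists_reached {n : ℕ} {C D : Column n} (hC : Admissible C) (hD : Admissible D)
    (hcard : D.card ≤ C.card)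
    (hle : ∀ x, cnt (rightCol C) x - cnt (leftCol D) x ≤ C.card - D.card) {j : ℕ}
    (hj : j ≤ C.card - D.card) : ∃ L R B E, Reached C D (C.card - D.card) j L R B E := by
  induction j with
  | zero =>
    refine ⟨leftCol C, rightCol C, leftCol D, rightCol D,
      ⟨0, SlideState.start hC hD hcard hle⟩, ?_, ?_, ?_, fun A hA => hA⟩
    · rw [unsplit_leftCol_rightCol hC, unsplit_leftCol_rightCol hD]
      exact SlidePath.start
    · rw [unsplit_leftCol_rightCol hC]; rfl
    · rw [unsplit_leftCol_rightCol hD]; rfl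
  | succ j ih =>
    obtain ⟨L, R, B, E, ⟨lo, h⟩, hpath, hcC, hcD, hkey⟩ := ih (by omega)
    obtain ⟨s, hs⟩ : ∃ s, C.card - D.card - j = s + 1 := ⟨C.card - D.card - j - 1, by omega⟩
    have hs' : C.card - D.card - (j + 1) = s := by omega
    rw [hs] at h
    obtain ⟨b, hb, hlo⟩ := h.exists_moves
    obtain ⟨e, he⟩ := h.exists_enters hb hlo
    obtain ⟨t, ht⟩ := exists_leaves h.left.le h.left.cnt_zero_eq b
    have h' := h.step hb hlo ht he
    have hrs := h.reverseSlide hb ht he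
    have e1 : (unsplit B E).card = B.card := by
      have := h.card_right
      rw [cnt_zero] at this
      exact_mod_cast this
    rw [← e1] at hrs
    have e2 := h'.card_left
    have e3 := h'.card_right
    have e4 := h.card_left
    have e5 := h.card_right
    have e6 := h.left.cnt_removeRight hb.mem ht 0
    have e7 := he.cnt_addLeft hb.notMem 0
    simp only [Nat.zero_le, if_true] at e6 e7
    refine ⟨_, _, _, _, ⟨b.val + 1, by rw [hs']; exact h'⟩, SlidePath.slide hpath (by omega) hrs,
      by omega, by omega, fun A hA => hkey A (h.keyRel_of_step hb ht he hA)⟩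

/-- The jeu de taquin on two columns can be carried out, and its result is determined by the left
column of the left column that is obtained. -/
theorem exists_swapLengths {n : ℕ} {C D : Column n} (hC : Admissible C) (hD : Admissible D)
    (hcard : D.card ≤ C.card)
    (hle : ∀ x, cnt (rightCol C) x - cnt (leftCol D) x ≤ C.card - D.card) :
    ∃ X Y, Admissible X ∧ X.card = D.card ∧
      KeyRel (leftCol C) (rightCol C) (leftCol D) (leftCol X) ∧
      ∀ C' D', SwapLengths C D C' D' ↔ C' = X ∧ D' = Y := by
  obtain ⟨L, R, B, E, ⟨lo, h⟩, hpath, hcC, hcD, hkey⟩ := exists_reached hC hD hcard hle le_rfl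
  rw [Nat.sub_self] at h
  -- After `C.card - D.card` slides both columns end in the same row, so no box can be added below
  -- the right column. Hence every path is an initial part of the one constructed.
  have hbound : ∀ {j C' D'}, SlidePath C D j C' D' → j ≤ C.card - D.card := by
    intro j C' D' hp
    induction hp with
    | start => omega
    | slide path corner _ ih =>
      rcases eq_or_lt_of_le ih with rfl | hlt
      · obtain ⟨rfl, rfl⟩ := path.unique hpath
        omega
      · omega
  refine ⟨unsplit L R, unsplit B E, h.left.admissible, by omega, ?_, fun C' D' => ⟨?_, ?_⟩⟩
  · rw [h.left.leftCol_rightCol_unsplit.1]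
    exact hkey _ h.keyRel_self
  · rintro ⟨⟨j, hp⟩, h1, h2⟩
    have hj := hbound hp
    obtain ⟨L', R', B', E', -, hpath', hcC', -, -⟩ := exists_reached hC hD hcard hle hj
    obtain ⟨rfl, rfl⟩ := hp.unique hpath'
    have : j = C.card - D.card := by omega
    subst this
    exact hp.unique hpath
  · rintro ⟨rfl, rfl⟩
    exact ⟨⟨_, hpath⟩, by omega, by omega⟩

/-! ### The direct way -/

/-- `u y` is the maximum of the values `g w` for `w ≥ y`. -/
def RunMax (g u : ℕ → ℤ) : Prop :=
  ∀ y, (∀ w, y ≤ w → g w ≤ u y) ∧ ∃ w, y ≤ w ∧ g w = u y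

theorem cnt_eq_of_gap {n : ℕ} {A : Finset (Letter n)} {x y : ℕ} (hxy : x ≤ y)
    (h : ∀ a ∈ A, x ≤ a.val → y ≤ a.val) : cnt A x = cnt A y := by
  simp only [cnt]
  congr 2
  apply Finset.filter_congr
  intro a ha
  have := h a ha
  omega

theorem unmatchedAux_subset {n : ℕ} (βs : List (Letter n)) (R : Finset (Letter n)) :
    unmatchedAux βs R ⊆ R := by
  induction βs generalizing R with
  | nil => simp [unmatchedAux]
  | cons β βs ih =>
    rw [unmatchedAux]
    split_ifs
    · exact (ih _).trans (Finset.erase_subset _ _)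
    · exact ih R

/-- Treating `β` leaves the running maximum unchanged. The old and new functions differ only on `(a,
β]` if `β` is matched with `a`, and on positions up to `β` if it is unmatched. -/
theorem runMax_unmatchedAux {n : ℕ} (βs : List (Letter n)) (h : βs.Pairwise (· > ·))
    (R : Finset (Letter n)) :
    RunMax (fun w => cnt R w - cnt βs.toFinset w) (cnt (unmatchedAux βs R)) := by
  induction βs generalizing R with
  | nil =>
    intro y
    simp only [unmatchedAux, List.toFinset_nil, cnt_empty, sub_zero]
    exact ⟨fun w hw => cnt_anti R hw, y, le_rfl, rfl⟩
  | cons β βs ih =>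
    rw [List.pairwise_cons] at h
    have hβ : β ∉ βs.toFinset := fun hβ => lt_irrefl _ (h.1 β (List.mem_toFinset.1 hβ))
    rw [unmatchedAux]
    split_ifs with hne
    · have hmem := Finset.max'_mem _ hne
      have hmax : ∀ a ∈ R.filter (· ≤ β), a ≤ (R.filter (· ≤ β)).max' hne :=
        fun a => Finset.le_max' _ a
      generalize (R.filter (· ≤ β)).max' hne = a at hmem hmax
      rw [Finset.mem_filter, Fin.le_def] at hmem
      have hc := cnt_erase hmem.1
      intro y
      obtain ⟨h1, w, h2, h3⟩ := ih h.2 (R.erase a) y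
      simp only [hc] at h1 h3
      simp only [List.toFinset_cons, cnt_insert hβ]
      refine ⟨fun w hw => ?_, ?_⟩
      · have := h1 w hw
        split_ifs at * <;> omega
      · by_cases hw : a.val < w ∧ w ≤ β.val
        -- `R` has no letter from `w` to `β`, so moving `w` to `β + 1` cannot decrease the
        -- difference, and at `β + 1` the two functions agree.
        · refine ⟨β.val + 1, by omega, ?_⟩
          have h4 := h1 (β.val + 1) (by omega)
          have h5 := cnt_anti βs.toFinset (x := w) (y := β.val + 1) (by omega)
          have h6 : cnt R w = cnt R (β.val + 1) := cnt_eq_of_gap (by omega) fun c hc hwc => by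
            by_contra hcon
            have := hmax c (Finset.mem_filter.2 ⟨hc, by rw [Fin.le_def]; omega⟩)
            rw [Fin.le_def] at this
            omega
          rw [if_neg (by omega)] at h3 h4 ⊢
          omega
        · refine ⟨w, h2, ?_⟩
          split_ifs at * <;> omega
    · have hno : ∀ c ∈ R, β.val < c.val := fun c hc => by
        by_contra hcon
        exact hne ⟨c, Finset.mem_filter.2 ⟨hc, by rw [Fin.le_def]; omega⟩⟩
      intro y
      obtain ⟨h1, w, h2, h3⟩ := ih h.2 R y
      simp only [List.toFinset_cons, cnt_insert hβ]
      refine ⟨fun w hw => ?_, ?_⟩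
      · have := h1 w hw
        dsimp only at this
        split_ifs <;> omega
      · by_cases hw : w ≤ β.val
        · refine ⟨β.val + 1, by omega, ?_⟩
          have h4 := h1 (β.val + 1) (by omega)
          have h5 := cnt_anti βs.toFinset (x := w) (y := β.val + 1) (by omega)
          have h6 : cnt R w = cnt R (β.val + 1) := cnt_eq_of_gap (by omega) fun c hc _ => hno c hc
          dsimp only at h3 h4
          rw [if_neg (by omega)]
          omega
        · refine ⟨w, h2, ?_⟩
          dsimp only at h3
          rw [if_neg hw]
          omega

theorem runMax_unmatched {n : ℕ} (R B : Column n) :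
    RunMax (fun w => cnt R w - cnt B w) (cnt (unmatched R B)) := by
  have h := runMax_unmatchedAux (rows B).reverse
    (by rw [List.pairwise_reverse]; exact rows_pairwise B) R
  have e : (rows B).reverse.toFinset = B := by ext x; simp [mem_rows]
  rw [e] at h
  exact h

theorem rows_erase {n : ℕ} (C : Column n) (b : Letter n) :
    (rows C).erase b = rows (C.erase b) := by
  have h1 : (rows C).Nodup := (rows_pairwise C).imp fun h => h.ne
  have h2 : ((rows C).erase b).toFinset = C.erase b := by
    ext x
    rw [List.mem_toFinset, h1.mem_erase_iff, mem_rows, Finset.mem_erase]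
  rw [← h2]
  symm
  exact (List.toFinset_sort (· ≤ ·) (h1.erase b)).2
    (((rows_pairwise C).imp fun h => h.le).sublist List.erase_sublist)

theorem rows_eraseIdx {n : ℕ} {C : Column n} {i : ℕ} {b : Letter n} (h : (rows C)[i]? = some b) :
    (rows C).eraseIdx i = rows (C.erase b) := by
  have h1 : (rows C).Nodup := (rows_pairwise C).imp fun h => h.ne
  obtain ⟨hi, rfl⟩ := List.getElem?_eq_some_iff.1 h
  rw [← rows_erase, h1.erase_getElem]

/-- Since the columns have equal length and `f ≤ 0`, an entry `a` of `L` below the top exceeds its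
Northeast neighbour exactly when `f a = 0`. At the top entry `f` always vanishes. So the search
upwards from the row of `b` ends at the last zero of `f` up to `b`, namely `t`. -/
theorem deletionRow_rows {n : ℕ} {L R : Column n} {b t : Letter n} (h0 : cnt L 0 = cnt R 0)
    (hle : ∀ x, cnt L x ≤ cnt R x) (hb : b ∈ R) (ht : Leaves L R b t) {q : ℕ}
    (hq : (rows R)[q]? = some b) :
    (rows L)[deletionRow (rows L) (rows R) q]? = some t := by
  have htL := (ht.mem hle hb).1
  have heq := ht.eq
  have htb := ht.le
  rw [rows_getElem?] at hq
  have hnn : 0 ≤ cnt L 0 - cnt L t.val := sub_nonneg.2 (cnt_anti L (Nat.zero_le _))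
  obtain ⟨k, hk⟩ := Int.eq_ofNat_of_zero_le hnn
  have hkt : (rows L)[k]? = some t := rows_getElem?.2 ⟨htL, hk⟩
  have hkq : k ≤ q := by
    have := cnt_anti R htb
    omega
  have hqR : (q : ℤ) < cnt R 0 := by
    have h1 := cnt_succ R b
    rw [ind_of_mem hb] at h1
    have := cnt_nonneg R (b.val + 1)
    omega
  have hcL := cnt_zero L
  have hcR := cnt_zero R
  suffices key : ∀ p, k ≤ p → p ≤ q → deletionRow (rows L) (rows R) p = k by
    rw [key q hkq le_rfl, hkt]
  intro p hp
  induction p with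
  | zero => intro _; simp only [deletionRow]; omega
  | succ p ih =>
    intro hpq
    have hlenL : p + 1 < (rows L).length := by rw [length_rows]; omega
    have hlenR : p < (rows R).length := by rw [length_rows]; omega
    have ha : (rows L)[p + 1]? = some (rows L)[p + 1] := List.getElem?_eq_getElem hlenL
    have hc : (rows R)[p]? = some (rows R)[p] := List.getElem?_eq_getElem hlenR
    rw [deletionRow]
    generalize (rows L)[p + 1] = a at ha
    generalize (rows R)[p] = c at hc
    simp only [ha, hc]
    rw [rows_getElem?] at ha hc
    have hca := cnt_succ R c
    rw [ind_of_mem hc.1] at hca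
    push_cast at ha
    rcases Nat.eq_or_lt_of_le hp with hp | hp
    · have hat : a = t := by
        rw [hp] at hkt
        have h1 : (rows L)[p + 1]? = some a := rows_getElem?.2 ⟨ha.1, by push_cast; exact ha.2⟩
        exact Option.some.inj (h1.symm.trans hkt)
      rw [if_pos, hp]
      rw [Fin.lt_def]
      by_contra hcon
      have := cnt_anti R (x := a.val) (y := c.val) (by omega)
      rw [hat] at this
      omega
    · rw [if_neg, ih (by omega) (by omega)]
      rw [Fin.lt_def]
      intro hlt
      have h1 := cnt_anti R (x := c.val + 1) (y := a.val) (by omega)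
      have h2 := hle a.val
      have h3 : t.val < a.val := by
        by_contra h3
        have := cnt_anti L (x := a.val) (y := t.val) (by omega)
        omega
      have h4 : a.val ≤ b.val := by
        by_contra h4
        have h5 := cnt_anti R (x := b.val + 1) (y := a.val) (by omega)
        have h6 := cnt_succ R b
        rw [ind_of_mem hb] at h6
        omega
      have := ht.lt a.val h3 h4
      omega

theorem deleteStep_rows {n : ℕ} {L R : Column n} {b t : Letter n} (h0 : cnt L 0 = cnt R 0)
    (hle : ∀ x, cnt L x ≤ cnt R x) (hb : b ∈ R) (ht : Leaves L R b t) :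
    deleteStep (rows L, rows R) b = (rows (L.erase t), rows (R.erase b)) := by
  have hq : (rows R)[(rows R).idxOf b]? = some b := List.getElem?_idxOf (mem_rows.2 hb)
  rw [deleteStep, rows_eraseIdx (deletionRow_rows h0 hle hb ht hq), rows_erase]

/-- Deleting `t` and the smallest unmatched letter `b` raises `f` on `(t, b]` and lowers the count
of remaining unmatched letters up to `b`; behind `t` the sum is unchanged. Only `f ≤ 0` and `f 0 =
0` are used, since these deletions do not preserve split pairs. -/
theorem foldl_deleteStep {n : ℕ} (us : List (Letter n)) (hus : us.Pairwise (· < ·))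
    {L R : Column n} (h0 : cnt L 0 = cnt R 0) (hle : ∀ x, cnt L x ≤ cnt R x)
    (hR : ∀ u ∈ us, u ∈ R) {A : Column n}
    (hA : A = (us.foldl deleteStep (rows L, rows R)).1.toFinset) :
    A ⊆ L ∧ RunMax (fun y => cnt L y - cnt R y + cnt us.toFinset y)
      (fun x => cnt L x - cnt A x) := by
  induction us generalizing L R with
  | nil =>
    have e : A = L := by rw [hA]; ext x; simp [mem_rows]
    subst e
    refine ⟨subset_rfl, fun y => ⟨fun w _ => ?_, y + 2 * n, by omega, ?_⟩⟩
    · have := hle w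
      simp only [List.toFinset_nil, cnt_empty]
      omega
    · simp only [List.toFinset_nil, cnt_empty]
      rw [cnt_of_le A (by omega), cnt_of_le R (by omega)]
      omega
  | cons b us ih =>
    rw [List.pairwise_cons] at hus
    have hb : b ∈ R := hR b List.mem_cons_self
    obtain ⟨t, ht⟩ := exists_leaves hle h0 b
    have htL := (ht.mem hle hb).1
    rw [List.foldl_cons, deleteStep_rows h0 hle hb ht] at hA
    have hcL := cnt_erase htL
    have hcR := cnt_erase hb
    have htb := ht.le
    have hlt := ht.lt
    have heq := ht.eq
    have hle' : ∀ x, cnt (L.erase t) x ≤ cnt (R.erase b) x := by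
      intro x
      have h1 := hle x
      have h2 := hlt x
      rw [hcL, hcR]
      split_ifs <;> omega
    obtain ⟨h1, h2⟩ := ih hus.2 (L := L.erase t) (R := R.erase b)
      (by rw [hcL, hcR, h0]; simp) hle'
      (fun u hu => Finset.mem_erase.2 ⟨(hus.1 u hu).ne', hR u (List.mem_cons_of_mem _ hu)⟩) hA
    refine ⟨h1.trans (Finset.erase_subset _ _), ?_⟩
    have hbu : b ∉ us.toFinset := fun hbu => lt_irrefl _ (hus.1 b (List.mem_toFinset.1 hbu))
    have hu0 : cnt us.toFinset t.val = cnt us.toFinset 0 := cnt_eq_of_forall fun u hu => by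
      have := hus.1 u (List.mem_toFinset.1 hu)
      rw [Fin.lt_def] at this
      omega
    intro x
    obtain ⟨h3, w, h4, h5⟩ := h2 x
    have h6 := hle' w
    have h7 := cnt_anti us.toFinset (Nat.zero_le w)
    simp only [hcL, hcR] at h3 h5 h6
    simp only [List.toFinset_cons, cnt_insert hbu]
    by_cases hxt : x ≤ t.val
    · have h8 := h3 t.val hxt
      rw [if_pos hxt] at h5 h8
      rw [if_pos le_rfl, if_pos htb] at h8
      -- For `x ≤ t` the maximum is the number of all unmatched letters, attained at `t`: there `f`
      -- vanishes and no unmatched letter lies before it.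
      refine ⟨fun y hy => ?_, t.val, hxt, ?_⟩
      · have h9 := hle y
        have h10 := cnt_anti us.toFinset (Nat.zero_le y)
        split_ifs <;> omega
      · rw [if_pos htb]
        omega
    · rw [if_neg hxt] at h5
      refine ⟨fun y hy => ?_, w, h4, ?_⟩
      · have h9 := h3 y hy
        rw [if_neg (by omega : ¬ y ≤ t.val), if_neg hxt] at h9
        omega
      · rw [if_neg (by omega : ¬ w ≤ t.val)] at h5
        omega

/-- The running maximum for the matching is inserted into the one for the deletions, which gives the
double maximum in `KeyRel`. -/
theorem deleteEntries_keyRel {n : ℕ} {C : Column n} (hC : Admissible C) (B : Column n) :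
    deleteEntries C B ⊆ leftCol C ∧
      KeyRel (leftCol C) (rightCol C) B (deleteEntries C B) := by
  have hs := split_of_admissible hC
  obtain ⟨h1, h2⟩ := foldl_deleteStep (rows (unmatched (rightCol C) B)) (rows_pairwise _)
    hs.cnt_zero_eq hs.le (fun u hu => unmatchedAux_subset _ _ (mem_rows.1 hu))
    (A := deleteEntries C B) rfl
  have e : (rows (unmatched (rightCol C) B)).toFinset = unmatched (rightCol C) B := by
    ext x; simp [mem_rows]
  rw [e] at h2
  have h3 := runMax_unmatched (rightCol C) B
  refine ⟨h1, fun x => ⟨fun y w hy hw => ?_, ?_⟩⟩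
  · have h4 := (h2 x).1 y hy
    have h5 := (h3 y).1 w hw
    dsimp only at h4 h5
    omega
  · obtain ⟨y, hy, h4⟩ := (h2 x).2
    obtain ⟨w, hw, h5⟩ := (h3 y).2
    dsimp only at h4 h5
    exact ⟨y, w, hy, hw, by omega⟩

/-! ### The first column -/

theorem RowLE.cnt_le {n : ℕ} {C D : Column n} (h : RowLE C D) (x : ℕ) :
    cnt D 0 - cnt D x ≤ cnt C 0 - cnt C x := by
  induction x with
  | zero => simp
  | succ x ih =>
    by_cases hx : x < 2 * n
    · let a : Letter n := ⟨x, hx⟩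
      have e1 : cnt C x = cnt C (x + 1) + ind C a := cnt_succ C a
      have e2 : cnt D x = cnt D (x + 1) + ind D a := cnt_succ D a
      have e3 := ind_nonneg C a
      by_cases haD : a ∈ D
      · rw [ind_of_mem haD] at e2
        have hnn : 0 ≤ cnt D 0 - cnt D x := sub_nonneg.2 (cnt_anti D (Nat.zero_le _))
        obtain ⟨q, hq⟩ := Int.eq_ofNat_of_zero_le hnn
        have h1 : (rows D)[q]? = some a := rows_getElem?.2 ⟨haD, hq⟩
        have hlen : q < (rows C).length := by
          have h2 := cnt_nonneg D (x + 1)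
          have h3 := cnt_zero D
          have h4 := h.1
          rw [length_rows]
          omega
        have h2 : (rows C)[q]? = some (rows C)[q] := List.getElem?_eq_getElem hlen
        generalize (rows C)[q] = c at h2
        have h3 := h.2 q c a h2 h1
        rw [rows_getElem?] at h2
        have h4 := cnt_succ C c
        rw [ind_of_mem h2.1] at h4
        have h5 : c.val ≤ x := h3
        have h6 := cnt_anti C (x := c.val + 1) (y := x + 1) (by omega)
        omega
      · rw [ind_of_notMem haD] at e2
        omega
    · have e1 := cnt_of_le D (x := x) (by omega)
      have e2 := cnt_of_le C (x := x) (by omega)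
      have e3 := cnt_of_le D (x := x + 1) (by omega)
      have e4 := cnt_of_le C (x := x + 1) (by omega)
      omega

theorem firstColumn_iff {n : ℕ} (T : List (Column n)) (hadm : ∀ C ∈ T, Admissible C)
    (hspl : Semistandard (spl T)) (hne : T ≠ []) :
    ∃ X, Admissible X ∧ X.card = (T.getLast hne).card ∧ leftCol X = directLeft T ∧
      directLeft T ⊆ leftCol (T.head hne) ∧ ∀ X', FirstColumn T X' ↔ X' = X := by
  induction T with
  | nil => exact absurd rfl hne
  | cons C T ih =>
    have hC := hadm C List.mem_cons_self
    cases T with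
    | nil =>
      refine ⟨C, hC, rfl, rfl, subset_rfl, fun X' => ⟨fun h => ?_, ?_⟩⟩
      · cases h; rfl
      · rintro rfl; exact FirstColumn.single _
    | cons D T =>
      have hD := hadm D (by simp)
      have e : spl (C :: D :: T) = leftCol C :: rightCol C :: leftCol D :: (rightCol D :: spl T) := by
        simp [spl]
      have e' : spl (D :: T) = leftCol D :: (rightCol D :: spl T) := by simp [spl]
      unfold Semistandard at hspl
      rw [e, List.isChain_cons_cons, List.isChain_cons_cons] at hspl
      obtain ⟨X, hX, hXcard, hXl, hsub, hiff⟩ := ih (fun Y hY => hadm Y (List.mem_cons_of_mem _ hY))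
        (by unfold Semistandard; rw [e']; exact hspl.2.2) (by simp)
      rw [List.head_cons, ← hXl] at hsub
      have hrow := hspl.2.1
      have h1 : cnt (rightCol C) 0 = C.card := by rw [cnt_zero, card_rightCol hC]
      have h2 : cnt (leftCol X) 0 = X.card := by rw [cnt_zero, card_leftCol hX]
      have hcard : X.card ≤ C.card := by
        have h3 := Finset.card_le_card hsub
        have h4 := hrow.1
        rw [card_leftCol hX] at h3
        rw [card_rightCol hC] at h4
        omega
      -- Before `x` there are at most as many letters of `ℓD` as of `rC`, and passing to the subset
      -- `ℓX` of `ℓD` only lowers the former number.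
      have hle : ∀ x, cnt (rightCol C) x - cnt (leftCol X) x ≤ C.card - X.card := by
        intro x
        have h3 := hrow.cnt_le x
        have h4 := cnt_anti (leftCol D \ leftCol X) (Nat.zero_le x)
        rw [cnt_sdiff hsub, cnt_sdiff hsub] at h4
        omega
      obtain ⟨X₁, Y₁, hX₁, hcard₁, hkey, hswap⟩ := exists_swapLengths hC hX hcard hle
      have hdel := deleteEntries_keyRel hC (leftCol X)
      have hl : leftCol X₁ = directLeft (C :: D :: T) := by
        rw [directLeft, ← hXl]
        exact hkey.unique hdel.2
      refine ⟨X₁, hX₁, by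
        rw [hcard₁, hXcard, List.getLast_cons (a := C) (List.cons_ne_nil D T)], hl, ?_, fun X' => ⟨?_, ?_⟩⟩
      · rw [directLeft, ← hXl]
        exact hdel.1
      · rintro (_ | ⟨rest, swap⟩)
        rw [(hiff _).1 rest] at swap
        exact ((hswap _ _).1 swap).1
      · rintro rfl
        exact FirstColumn.cons ((hiff X).2 rfl) ((hswap _ _).2 ⟨rfl, rfl⟩)

end KN

/-! ### The theorem -/

theorem theorem7p1 (n : ℕ) (T : List (KN.Column n)) (hT : KN.IsTableau T) (hne : T ≠ []) :
    KN.directLeft T ⊆ KN.leftCol (T.head hne) ∧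
    (KN.directLeft T).card = (T.getLast hne).card ∧
    ∀ K : KN.Column n, KN.IsLeftKeyColumn T K ↔ K = KN.directLeft T := by
  obtain ⟨X, hX, hcard, hl, hsub, hiff⟩ :=
    KN.firstColumn_iff T hT.admissible hT.split_semistandard hne
  refine ⟨hsub, by rw [← hl, KN.card_leftCol hX, hcard], fun K => ⟨?_, ?_⟩⟩
  · rintro ⟨Y, hY, rfl⟩
    rw [(hiff Y).1 hY, hl]
  · rintro rfl
    exact ⟨X, (hiff X).2 rfl, hl.symm⟩
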